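/- Let $\Omega\subset\mathbb{R}^d$, $d\in\{2,3\}$, be a bounded Lipschitz domain (open, connected, non-empty) with boundary $\Gamma=\partial\Omega$. Put $V=H^1(\Omega)$, $V_p=H^1(\Gamma)$, let $B\colon V\to H^{1/2}(\Gamma)$, $Bu=u|_\Gamma$, be the trace operator onto its range $H^{1/2}(\Gamma)$, and let $Q=H^{-1/2}(\Gamma)$ be the dual of $H^{1/2}(\Gamma)$, so that $Q\subset V_p^*$ by restriction to $V_p\subset H^{1/2}(\Gamma)$. Put $\langle K_\Omega u,v\rangle=\int_\Omega\nabla u\cdot\nabla v\,dx$ and $\langle K_\Gamma p,q\rangle=\int_\Gamma\nabla_\Gamma p\cdot\nabla_\Gamma q\,dx$. Let $\varepsilon,\sigma,\delta,\kappa>0$, and let $W=W_+-W_-$ on an open interval $I$ and $W_\Gamma=W_{\Gamma,+}-W_{\Gamma,-}$ on an open interval $I_\Gamma$, where $W_\pm$, $W_{\Gamma,\pm}$ are convex and differentiable (for example $I=I_\Gamma=\mathbb{R}$, or $I=I_\Gamma=(-1,1)$). The Cahn–Hilliard equation with Allen–Cahn type dynamic boundary conditions is the PDAE $$\dot u+\sigma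 K_\Omega w=0\ \text{in }V^*,\qquad \varepsilon K_\Omega u+\varepsilon^{-1}W'(u)-\varepsilon B^*\lambda=w\ \text{in }V^*,$$ $$\dot p+\delta\kappa K_\Gamma p+\delta^{-1}W_\Gamma'(p)+\varepsilon\lambda=0\ \text{in }V_p^*,\qquad Bu-p=0\ \text{in }Q^*,$$ for $u,w$ with values in $V$, $p$ with values in $V_p$, $\lambda$ with values in $Q$. The first-order convex–concave splitting scheme with step size $\tau>0$ is: for $n\ge0$ find $u^{n+1},w^{n+1}\in V$, $p^{n+1}\in V_p$, $\lambda^{n+1}\in Q$ with $$u^{n+1}+\tau\sigma K_\Omega w^{n+1}=u^n\ \text{in }V^*,$$ $$\varepsilon K_\Omega u^{n+1}+\varepsilon^{-1}\big[W_+'(u^{n+1})-W_-'(u^n)\big]-\varepsilon B^*\lambda^{n+1}=w^{n+1}\ \text{in }V^*,$$ $$p^{n+1}+\tau\delta\kappa K_\Gamma p^{n+1}+\tau\delta^{-1}\big[W_{\Gamma,+}'(p^{n+1})-W_{\Gamma,-}'(p^n)\big]+\tau\varepsilon\lambda^{n+1}=p^n\ \text{in }V_p^*,$$ $$Bu^{n+1}-p^{n+1}=0\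 \text{in }Q^*.$$ Here $u,u^n$ take values in $I$ and $p,p^n$ in $I_\Gamma$ almost everywhere, and the nonlinear terms are understood as elements of $V^*$, $V_p^*$ through $v\mapsto\int_\Omega f\,v\,dx$, $q\mapsto\int_\Gamma f\,q\,dx$; in particular these integrals of $W'(u)v$, $W_+'(u^{n+1})v$, $W_-'(u^n)v$ and of $W_\Gamma'(p)q$, $W_{\Gamma,+}'(p^{n+1})q$, $W_{\Gamma,-}'(p^n)q$ converge absolutely for all $v\in V$, $q\in V_p$. The energy of $u\in V$ with $u|_\Gamma\in V_p$ is $$E(u)=\int_\Omega\frac\varepsilon2|\nabla u|^2+\frac1\varepsilon W(u)\,dx+\int_\Gamma\frac{\delta\kappa}2|\nabla_\Gamma u|^2+\frac1\delta W_\Gamma(u)\,dx .$$ **(i) Energy dissipation.** Let $\tau>0$ and let $(u^n,w^n,p^n,\lambda^n)$ satisfy the scheme for all $n\ge0$, with consistent initial data $u^0\in V$, $p^0=u^0|_\Gamma\in V_p$ of finite energy ($W(u^0)\in L^1(\Omega)$, $W_\Gamma(p^0)\in L^1(\Gamma)$). Then, for all $n\ge0$, $p^n=u^n|_\Gamma$,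 the energy $E(u^n)$ is finite, and $E(u^{n+1})\le E(u^n)$. **(ii) First-order accuracy.** Let $J\subseteq I$ and $J_\Gamma\subseteq I_\Gamma$ be sets on which $W_-'$, respectively $W_{\Gamma,-}'$, is Lipschitz continuous (for instance compact subsets if $W_-,W_{\Gamma,-}$ are $C^2$, or $J=J_\Gamma=\mathbb{R}$ if $W_-''$ and $W_{\Gamma,-}''$ exist and are bounded on $\mathbb{R}$). Let $T>0$ and let $(u,w,p,\lambda)$ satisfy the PDAE at every $t\in[0,T]$, with $u\in C^1([0,T];L^2(\Omega))$, $w\in C^1([0,T];H^1(\Omega))$, $p\in C^2([0,T];L^2(\Gamma))$, and with $u(t)$, $p(t)$ taking values in $J$, $J_\Gamma$ almost everywhere, for every $t\in[0,T]$. Then there are $C$ and $\tau_0>0$ such that, for all $0<\tau\le\tau_0$, all $N\in\mathbb{N}$ with $N\tau\le T$, and all $(u^n,w^n,p^n,\lambda^n)$ that satisfy the scheme for $0\le n<N$ with the (consistent) initial data $u^0=u(0)$, $p^0=p(0)$ and with $u^n$, $p^n$ taking values in $J$, $J_\Gamma$ almost everywhere for $n\le N$, $$\max_{0\le n\le N}\|u(n\tau)-u^n\|_{H^1(\Omega)^*}\le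 C\tau,\qquad \max_{0\le n\le N}\|p(n\tau)-p^n\|_{L^2(\Gamma)}\le C\tau,$$ $$\Big(\sum_{n=1}^N\tau\|u(n\tau)-u^n\|_{H^1(\Omega)}^2\Big)^{1/2}\le C\tau,\qquad \Big(\sum_{n=1}^N\tau\|p(n\tau)-p^n\|_{H^1(\Gamma)}^2\Big)^{1/2}\le C\tau .$$ -/

import Mathlib

open MeasureTheory Set
open scoped ContDiff NNReal

noncomputable section

namespace CahnHilliard

/-! ### Domains, boundaries and function spaces -/

/-- The Euclidean space `ℝ^d`. -/
abbrev Space (d : ℕ) : Type := EuclideanSpace ℝ (Fin d)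

/-- A bounded Lipschitz domain: a nonempty, connected, bounded open set which near each of its
boundary points is, after a rotation, the region strictly below the graph of a Lipschitz function.
The rotation is encoded by the unit vector `ν` (the "vertical" direction);
`y - ⟪ν, y⟫ ν` are the "horizontal" coordinates of `y`. -/
structure IsBoundedLipschitzDomain {d : ℕ} (Ω : Set (Space d)) : Prop where
  isOpen : IsOpen Ω
  isConnected : IsConnected Ω
  isBounded : Bornology.IsBounded Ω
  lipschitz_boundary : ∀ x ∈ frontier Ω, ∃ (U : Set (Space d)) (ν : Space d) (K : ℝ≥0)
    (ψ : Space d → ℝ), IsOpen U ∧ x ∈ U ∧ ‖ν‖ = 1 ∧ LipschitzWith K ψ ∧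
      ∀ y ∈ U, (y ∈ Ω ↔ inner ℝ ν y < ψ (y - (inner ℝ ν y) • ν))

/-- The Lebesgue measure on the bulk domain `Ω`. -/
def bulkMeasure {d : ℕ} (Ω : Set (Space d)) : Measure (Space d) := volume.restrict Ω

/-- The surface measure on `Γ = ∂Ω`: the `(d-1)`-dimensional Hausdorff measure, in the
normalization that agrees with Lebesgue measure on hyperplanes. -/
def surfMeasure {d : ℕ} (Ω : Set (Space d)) : Measure (Space d) :=
  (Measure.euclideanHausdorffMeasure (d - 1)).restrict (frontier Ω)

/-- `L²(Ω)`. -/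
abbrev L2Bulk {d : ℕ} (Ω : Set (Space d)) : Type := Lp ℝ 2 (bulkMeasure Ω)

/-- `L²(Ω; ℝ^d)`. -/
abbrev L2BulkVec {d : ℕ} (Ω : Set (Space d)) : Type := Lp (Space d) 2 (bulkMeasure Ω)

/-- `L²(Γ)`. -/
abbrev L2Surf {d : ℕ} (Ω : Set (Space d)) : Type := Lp ℝ 2 (surfMeasure Ω)

/-- `L²(Γ; ℝ^d)`. -/
abbrev L2SurfVec {d : ℕ} (Ω : Set (Space d)) : Type := Lp (Space d) 2 (surfMeasure Ω)

/-- `g` is the weak gradient of `u` in `Ω`. -/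
def IsWeakGradient {d : ℕ} (Ω : Set (Space d)) (u : L2Bulk Ω) (g : L2BulkVec Ω) : Prop :=
  ∀ φ : Space d → ℝ, ContDiff ℝ ∞ φ → HasCompactSupport φ → tsupport φ ⊆ Ω →
    ∫ x, u x • gradient φ x ∂(bulkMeasure Ω) = - ∫ x, φ x • g x ∂(bulkMeasure Ω)

theorem integrable_smul_gradient {d : ℕ} (Ω : Set (Space d)) (u : L2Bulk Ω)
    {φ : Space d → ℝ} (hφ : ContDiff ℝ ∞ φ) (hc : HasCompactSupport φ) :
    Integrable (fun x => u x • gradient φ x) (bulkMeasure Ω) := by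
  have : IsLocallyFiniteMeasure (bulkMeasure Ω) := by unfold bulkMeasure; infer_instance
  have h1 : Continuous (gradient φ) :=
    (InnerProductSpace.toDual ℝ (Space d)).symm.continuous.comp
      (hφ.continuous_fderiv (by simp))
  have h2 : HasCompactSupport (gradient φ) := by
    have h := hc.fderiv (𝕜 := ℝ)
    exact h.comp_left (g := (InnerProductSpace.toDual ℝ (Space d)).symm) (map_zero _)
  have h3 : MemLp (gradient φ) 2 (bulkMeasure Ω) := h1.memLp_of_hasCompactSupport h2
  exact memLp_one_iff_integrable.1 (h3.smul (Lp.memLp u))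

theorem integrable_smul_field {d : ℕ} (Ω : Set (Space d)) (g : L2BulkVec Ω)
    {φ : Space d → ℝ} (hφ : ContDiff ℝ ∞ φ) (hc : HasCompactSupport φ) :
    Integrable (fun x => φ x • g x) (bulkMeasure Ω) := by
  have : IsLocallyFiniteMeasure (bulkMeasure Ω) := by unfold bulkMeasure; infer_instance
  have h3 : MemLp φ 2 (bulkMeasure Ω) := hφ.continuous.memLp_of_hasCompactSupport hc
  exact memLp_one_iff_integrable.1 ((Lp.memLp g).smul h3)

/-- The Sobolev space `V = H¹(Ω)`: the pairs `(u, ∇u)` of `u ∈ L²(Ω)` and its weak gradient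
`∇u ∈ L²(Ω; ℝ^d)`, with the norm `(‖u‖² + ‖∇u‖²)^{1/2}`. -/
def H1Bulk {d : ℕ} (Ω : Set (Space d)) :
    Submodule ℝ (WithLp 2 (L2Bulk Ω × L2BulkVec Ω)) where
  carrier := {x | IsWeakGradient Ω x.fst x.snd}
  zero_mem' := by
    intro φ _ _ _
    have h1 : ∫ x, ((0 : L2Bulk Ω) x) • gradient φ x ∂(bulkMeasure Ω) = 0 := by
      refine integral_eq_zero_of_ae ?_
      filter_upwards [Lp.coeFn_zero ℝ 2 (bulkMeasure Ω)] with x hx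
      rw [hx, Pi.zero_apply, zero_smul, Pi.zero_apply]
    have h2 : ∫ x, φ x • ((0 : L2BulkVec Ω) x) ∂(bulkMeasure Ω) = 0 := by
      refine integral_eq_zero_of_ae ?_
      filter_upwards [Lp.coeFn_zero (Space d) 2 (bulkMeasure Ω)] with x hx
      rw [hx, Pi.zero_apply, smul_zero]
    simp only [WithLp.zero_fst, WithLp.zero_snd]
    rw [h1, h2, neg_zero]
  add_mem' := by
    intro a b ha hb φ h1 h2 h3
    have e1 : ∫ x, ((a.fst + b.fst : L2Bulk Ω) x) • gradient φ x ∂(bulkMeasure Ω)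
        = ∫ x, a.fst x • gradient φ x + b.fst x • gradient φ x ∂(bulkMeasure Ω) := by
      refine integral_congr_ae ?_
      filter_upwards [Lp.coeFn_add a.fst b.fst] with x hx
      rw [hx, Pi.add_apply, add_smul]
    have e2 : ∫ x, φ x • ((a.snd + b.snd : L2BulkVec Ω) x) ∂(bulkMeasure Ω)
        = ∫ x, φ x • a.snd x + φ x • b.snd x ∂(bulkMeasure Ω) := by
      refine integral_congr_ae ?_
      filter_upwards [Lp.coeFn_add a.snd b.snd] with x hx
      rw [hx, Pi.add_apply, smul_add]
    simp only [WithLp.add_fst, WithLp.add_snd]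
    rw [e1, e2, integral_add (integrable_smul_gradient Ω _ h1 h2)
      (integrable_smul_gradient Ω _ h1 h2), integral_add (integrable_smul_field Ω _ h1 h2)
      (integrable_smul_field Ω _ h1 h2), ha φ h1 h2 h3, hb φ h1 h2 h3, neg_add]
  smul_mem' := by
    intro c a ha φ h1 h2 h3
    have e1 : ∫ x, ((c • a.fst : L2Bulk Ω) x) • gradient φ x ∂(bulkMeasure Ω)
        = ∫ x, c • (a.fst x • gradient φ x) ∂(bulkMeasure Ω) := by
      refine integral_congr_ae ?_
      filter_upwards [Lp.coeFn_smul c a.fst] with x hx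
      simp [hx, mul_smul]
    have e2 : ∫ x, φ x • ((c • a.snd : L2BulkVec Ω) x) ∂(bulkMeasure Ω)
        = ∫ x, c • (φ x • a.snd x) ∂(bulkMeasure Ω) := by
      refine integral_congr_ae ?_
      filter_upwards [Lp.coeFn_smul c a.snd] with x hx
      simp [hx, smul_comm c]
    simp only [WithLp.smul_fst, WithLp.smul_snd]
    rw [e1, e2, integral_smul, integral_smul, ha φ h1 h2 h3, smul_neg]

/-- The underlying function `u ∈ L²(Ω)` of `u ∈ H¹(Ω)`. -/
def bulkFn {d : ℕ} {Ω : Set (Space d)} (u : H1Bulk Ω) : L2Bulk Ω := u.1.fst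

/-- The gradient `∇u ∈ L²(Ω; ℝ^d)` of `u ∈ H¹(Ω)`. -/
def bulkGrad {d : ℕ} {Ω : Set (Space d)} (u : H1Bulk Ω) : L2BulkVec Ω := u.1.snd

/-- The tangential gradient on `Γ = ∂Ω` of a smooth function `φ` on `ℝ^d`: the orthogonal
projection of `∇φ(x)` to the tangent space of `Γ` at `x` (the span of the tangent cone, which at
almost every point of a Lipschitz boundary is a hyperplane). -/
def tangentialGradient {d : ℕ} (Ω : Set (Space d)) (φ : Space d → ℝ) (x : Space d) : Space d :=
  (Submodule.span ℝ (tangentConeAt ℝ (frontier Ω) x)).starProjection (gradient φ x)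

/-- The pairs `(φ|_Γ, ∇_Γ φ)` for smooth functions `φ` on `ℝ^d`. -/
def smoothSurf {d : ℕ} (Ω : Set (Space d)) :
    Submodule ℝ (WithLp 2 (L2Surf Ω × L2SurfVec Ω)) where
  carrier := {x | ∃ φ : Space d → ℝ, ContDiff ℝ ∞ φ ∧ x.fst =ᵐ[surfMeasure Ω] φ ∧
    x.snd =ᵐ[surfMeasure Ω] tangentialGradient Ω φ}
  zero_mem' := by
    refine ⟨0, contDiff_const, Lp.coeFn_zero ℝ 2 (surfMeasure Ω), ?_⟩
    filter_upwards [Lp.coeFn_zero (Space d) 2 (surfMeasure Ω)] with x hx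
    have hx' : (WithLp.snd (0 : WithLp 2 (L2Surf Ω × L2SurfVec Ω))) x = 0 := hx
    have hg : gradient (0 : Space d → ℝ) x = 0 := gradient_fun_const x 0
    rw [hx', tangentialGradient, hg, map_zero]
  add_mem' := by
    rintro a b ⟨φ, h1, h2, h3⟩ ⟨χ, k1, k2, k3⟩
    refine ⟨φ + χ, h1.add k1, ?_, ?_⟩
    · filter_upwards [Lp.coeFn_add a.fst b.fst, h2, k2] with x hx e1 e2
      rw [WithLp.add_fst, hx, Pi.add_apply, Pi.add_apply, e1, e2]
    · filter_upwards [Lp.coeFn_add a.snd b.snd, h3, k3] with x hx e1 e2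
      have d1 : DifferentiableAt ℝ φ x := (h1.differentiable (by simp)) x
      have d2 : DifferentiableAt ℝ χ x := (k1.differentiable (by simp)) x
      have hg : gradient (φ + χ) x = gradient φ x + gradient χ x := by
        simp [gradient, fderiv_add d1 d2]
      simp only [WithLp.add_snd, hx, Pi.add_apply, e1, e2, tangentialGradient, hg, map_add]
  smul_mem' := by
    rintro c a ⟨φ, h1, h2, h3⟩
    refine ⟨c • φ, contDiff_const.smul h1, ?_, ?_⟩
    · filter_upwards [Lp.coeFn_smul c a.fst, h2] with x hx e1
      simp [hx, e1]
    · filter_upwards [Lp.coeFn_smul c a.snd, h3] with x hx e1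
      have d1 : DifferentiableAt ℝ φ x := (h1.differentiable (by simp)) x
      have hg : gradient (c • φ) x = c • gradient φ x := by
        simp [gradient, fderiv_const_smul d1]
      simp only [WithLp.smul_snd, hx, Pi.smul_apply, e1, tangentialGradient, hg, map_smul]

/-- The Sobolev space `V_p = H¹(Γ)`: the pairs `(p, ∇_Γ p)` in the closure, in the norm
`(‖p‖_Γ² + ‖∇_Γ p‖_Γ²)^{1/2}`, of the smooth functions with their tangential gradients. -/
def H1Surf {d : ℕ} (Ω : Set (Space d)) :
    Submodule ℝ (WithLp 2 (L2Surf Ω × L2SurfVec Ω)) := (smoothSurf Ω).topologicalClosure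

/-- The underlying function `p ∈ L²(Γ)` of `p ∈ H¹(Γ)`. -/
def surfFn {d : ℕ} {Ω : Set (Space d)} (p : H1Surf Ω) : L2Surf Ω := p.1.fst

/-- The surface gradient `∇_Γ p ∈ L²(Γ; ℝ^d)` of `p ∈ H¹(Γ)`. -/
def surfGrad {d : ℕ} {Ω : Set (Space d)} (p : H1Surf Ω) : L2SurfVec Ω := p.1.snd

/-- The graph of the restriction map `φ|_Ω ↦ φ|_Γ` on smooth functions. -/
def smoothTrace {d : ℕ} (Ω : Set (Space d)) : Submodule ℝ (H1Bulk Ω × L2Surf Ω) where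
  carrier := {x | ∃ φ : Space d → ℝ, ContDiff ℝ ∞ φ ∧ bulkFn x.1 =ᵐ[bulkMeasure Ω] φ ∧
    x.2 =ᵐ[surfMeasure Ω] φ}
  zero_mem' := ⟨0, contDiff_const, Lp.coeFn_zero ℝ 2 (bulkMeasure Ω),
    Lp.coeFn_zero ℝ 2 (surfMeasure Ω)⟩
  add_mem' := by
    rintro a b ⟨φ, h1, h2, h3⟩ ⟨χ, k1, k2, k3⟩
    refine ⟨φ + χ, h1.add k1, ?_, ?_⟩
    · filter_upwards [Lp.coeFn_add (bulkFn a.1) (bulkFn b.1), h2, k2] with x hx e1 e2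
      have : bulkFn (a + b).1 = bulkFn a.1 + bulkFn b.1 := rfl
      rw [this, hx, Pi.add_apply, Pi.add_apply, e1, e2]
    · filter_upwards [Lp.coeFn_add a.2 b.2, h3, k3] with x hx e1 e2
      rw [Prod.snd_add, hx, Pi.add_apply, Pi.add_apply, e1, e2]
  smul_mem' := by
    rintro c a ⟨φ, h1, h2, h3⟩
    refine ⟨c • φ, contDiff_const.smul h1, ?_, ?_⟩
    · filter_upwards [Lp.coeFn_smul c (bulkFn a.1), h2] with x hx e1
      have : bulkFn (c • a).1 = c • bulkFn a.1 := rfl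
      rw [this, hx, Pi.smul_apply, Pi.smul_apply, e1]
    · filter_upwards [Lp.coeFn_smul c a.2, h3] with x hx e1
      simp [hx, e1]

/-- The graph of the trace operator `B : H¹(Ω) → L²(Γ)`, i.e. of the continuous extension of the
restriction map `φ|_Ω ↦ φ|_Γ` from smooth functions to `H¹(Ω)`. -/
def traceGraph {d : ℕ} (Ω : Set (Space d)) : Submodule ℝ (H1Bulk Ω × L2Surf Ω) :=
  (smoothTrace Ω).topologicalClosure

/-- `g` is the trace `u|_Γ = B u` of `u ∈ H¹(Ω)`. -/
def IsTrace {d : ℕ} {Ω : Set (Space d)} (u : H1Bulk Ω) (g : L2Surf Ω) : Prop :=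
  (u, g) ∈ traceGraph Ω

/-- The trace space `H^{1/2}(Γ) = B(H¹(Ω)) ⊆ L²(Γ)`. -/
def HHalf {d : ℕ} (Ω : Set (Space d)) : Submodule ℝ (L2Surf Ω) :=
  (traceGraph Ω).map (LinearMap.snd ℝ (H1Bulk Ω) (L2Surf Ω))

/-- `Q = H^{-1/2}(Γ)`: the linear functionals on `H^{1/2}(Γ)` that are continuous for the norm
`‖g‖ = inf {‖v‖_{H¹(Ω)} : B v = g}` of the trace space. -/
structure HNegHalf {d : ℕ} (Ω : Set (Space d)) where
  toFun : HHalf Ω →ₗ[ℝ] ℝ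
  bounded : ∃ C : ℝ, ∀ (v : H1Bulk Ω) (g : HHalf Ω), IsTrace v (g : L2Surf Ω) →
    |toFun g| ≤ C * ‖v‖

/-! ### The model -/

/-- The data of the Cahn–Hilliard model with Allen–Cahn type dynamic boundary conditions, with
convex–concave splittings `W = W₊ - W₋` and `W_Γ = W_{Γ,+} - W_{Γ,-}` of the two potentials.
The potentials live on open intervals `I`, `I_Γ` (for instance `ℝ` for the polynomial double well,
or `(-1, 1)` for the logarithmic one); their values outside are irrelevant. -/
structure Model where
  ε : ℝ
  σ : ℝ
  δ : ℝ
  κ : ℝ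
  I : Set ℝ
  IΓ : Set ℝ
  Wp : ℝ → ℝ
  Wm : ℝ → ℝ
  WΓp : ℝ → ℝ
  WΓm : ℝ → ℝ
  ε_pos : 0 < ε
  σ_pos : 0 < σ
  δ_pos : 0 < δ
  κ_pos : 0 < κ
  isOpen_I : IsOpen I
  isOpen_IΓ : IsOpen IΓ
  convex_Wp : ConvexOn ℝ I Wp
  convex_Wm : ConvexOn ℝ I Wm
  convex_WΓp : ConvexOn ℝ IΓ WΓp
  convex_WΓm : ConvexOn ℝ IΓ WΓm
  diff_Wp : DifferentiableOn ℝ Wp I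
  diff_Wm : DifferentiableOn ℝ Wm I
  diff_WΓp : DifferentiableOn ℝ WΓp IΓ
  diff_WΓm : DifferentiableOn ℝ WΓm IΓ

/-- The bulk potential `W = W₊ - W₋`. -/
def Model.W (M : Model) (s : ℝ) : ℝ := M.Wp s - M.Wm s

/-- The boundary potential `W_Γ = W_{Γ,+} - W_{Γ,-}`. -/
def Model.WΓ (M : Model) (s : ℝ) : ℝ := M.WΓp s - M.WΓm s

/-- The bulk free energy. -/
def Model.bulkEnergy (M : Model) {d : ℕ} {Ω : Set (Space d)} (u : H1Bulk Ω) : ℝ :=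
  ∫ x, (M.ε / 2 * inner ℝ (bulkGrad u x) (bulkGrad u x) + M.ε⁻¹ * M.W (bulkFn u x))
    ∂(bulkMeasure Ω)

/-- The surface free energy, as a function of `p = u|_Γ`. -/
def Model.surfEnergy (M : Model) {d : ℕ} {Ω : Set (Space d)} (p : H1Surf Ω) : ℝ :=
  ∫ x, (M.δ * M.κ / 2 * inner ℝ (surfGrad p x) (surfGrad p x) + M.δ⁻¹ * M.WΓ (surfFn p x))
    ∂(surfMeasure Ω)

/-- The total energy `E(u) = E_bulk(u) + E_surf(u)`, where `p = u|_Γ`. -/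
def Model.energy (M : Model) {d : ℕ} {Ω : Set (Space d)} (u : H1Bulk Ω) (p : H1Surf Ω) : ℝ :=
  M.bulkEnergy u + M.surfEnergy p

/-- The potential parts of `E(u)` are integrable, i.e. `E(u)` is finite (`p = u|_Γ`). -/
def Model.HasFiniteEnergy (M : Model) {d : ℕ} {Ω : Set (Space d)} (u : H1Bulk Ω)
    (p : H1Surf Ω) : Prop :=
  Integrable (fun x => M.W (bulkFn u x)) (bulkMeasure Ω) ∧
    Integrable (fun x => M.WΓ (surfFn p x)) (surfMeasure Ω)

/-- `u` takes its values in `J` (almost everywhere in `Ω`) and `p` takes its values in `JΓ`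
(almost everywhere on `Γ`). -/
def ValuesIn {d : ℕ} {Ω : Set (Space d)} (u : H1Bulk Ω) (p : H1Surf Ω) (J JΓ : Set ℝ) : Prop :=
  (∀ᵐ x ∂(bulkMeasure Ω), bulkFn u x ∈ J) ∧ (∀ᵐ x ∂(surfMeasure Ω), surfFn p x ∈ JΓ)

/-- The function `f` on `Ω` acts on `H¹(Ω)` by `v ↦ ∫_Ω f v dx`. -/
def ActsOnBulk {d : ℕ} (Ω : Set (Space d)) (f : Space d → ℝ) : Prop :=
  ∀ v : H1Bulk Ω, Integrable (fun x => f x * bulkFn v x) (bulkMeasure Ω)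

/-- The function `f` on `Γ` acts on `H¹(Γ)` by `q ↦ ∫_Γ f q dx`. -/
def ActsOnSurf {d : ℕ} (Ω : Set (Space d)) (f : Space d → ℝ) : Prop :=
  ∀ q : H1Surf Ω, Integrable (fun x => f x * surfFn q x) (surfMeasure Ω)

/-- One step of the first-order convex–concave splitting scheme with step size `τ`, leading from
`(u, p) = (uⁿ, pⁿ)` to `(u', w', p', lam') = (uⁿ⁺¹, wⁿ⁺¹, pⁿ⁺¹, λⁿ⁺¹)`.
(On a Lipschitz boundary `H¹(Γ) ⊆ H^{1/2}(Γ)`, so that in `eq_c` the membership `hq` holds for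
every `q`.) -/
structure Model.IsStep (M : Model) {d : ℕ} {Ω : Set (Space d)} (τ : ℝ)
    (u : H1Bulk Ω) (p : H1Surf Ω)
    (u' w' : H1Bulk Ω) (p' : H1Surf Ω) (lam' : HNegHalf Ω) : Prop where
  values : ValuesIn u p M.I M.IΓ
  values' : ValuesIn u' p' M.I M.IΓ
  acts_Wp : ActsOnBulk Ω (fun x => deriv M.Wp (bulkFn u' x))
  acts_Wm : ActsOnBulk Ω (fun x => deriv M.Wm (bulkFn u x))
  acts_WΓp : ActsOnSurf Ω (fun x => deriv M.WΓp (surfFn p' x))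
  acts_WΓm : ActsOnSurf Ω (fun x => deriv M.WΓm (surfFn p x))
  eq_a : ∀ v : H1Bulk Ω,
    inner ℝ (bulkFn u') (bulkFn v) + τ * M.σ * inner ℝ (bulkGrad w') (bulkGrad v)
      = inner ℝ (bulkFn u) (bulkFn v)
  eq_b : ∀ (v : H1Bulk Ω) (g : HHalf Ω), IsTrace v (g : L2Surf Ω) →
    M.ε * inner ℝ (bulkGrad u') (bulkGrad v)
      + M.ε⁻¹ * (∫ x, (deriv M.Wp (bulkFn u' x) - deriv M.Wm (bulkFn u x)) * bulkFn v x
          ∂(bulkMeasure Ω))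
      - M.ε * lam'.toFun g = inner ℝ (bulkFn w') (bulkFn v)
  eq_c : ∀ (q : H1Surf Ω) (hq : surfFn q ∈ HHalf Ω),
    inner ℝ (surfFn p') (surfFn q) + τ * M.δ * M.κ * inner ℝ (surfGrad p') (surfGrad q)
      + τ * M.δ⁻¹ * (∫ x, (deriv M.WΓp (surfFn p' x) - deriv M.WΓm (surfFn p x)) * surfFn q x
          ∂(surfMeasure Ω))
      + τ * M.ε * lam'.toFun ⟨surfFn q, hq⟩ = inner ℝ (surfFn p) (surfFn q)
  eq_d : IsTrace u' (surfFn p')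

/-- A (sufficiently regular) solution `(u, w, p, λ)` on `[0, T]` of the PDAE formulation of the
Cahn–Hilliard equation with Allen–Cahn type dynamic boundary conditions. -/
structure Model.IsRegularSolution (M : Model) {d : ℕ} {Ω : Set (Space d)} (T : ℝ)
    (u w : ℝ → H1Bulk Ω) (p : ℝ → H1Surf Ω) (lam : ℝ → HNegHalf Ω) : Prop where
  reg_u : ContDiffOn ℝ 1 (fun t => bulkFn (u t)) (Icc 0 T)
  reg_w : ContDiffOn ℝ 1 w (Icc 0 T)
  reg_p : ContDiffOn ℝ 2 (fun t => surfFn (p t)) (Icc 0 T)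
  values : ∀ t ∈ Icc 0 T, ValuesIn (u t) (p t) M.I M.IΓ
  acts_W : ∀ t ∈ Icc 0 T, ActsOnBulk Ω (fun x => deriv M.W (bulkFn (u t) x))
  acts_WΓ : ∀ t ∈ Icc 0 T, ActsOnSurf Ω (fun x => deriv M.WΓ (surfFn (p t) x))
  eq_a : ∀ t ∈ Icc 0 T, ∀ v : H1Bulk Ω,
    inner ℝ (derivWithin (fun s => bulkFn (u s)) (Icc 0 T) t) (bulkFn v)
      + M.σ * inner ℝ (bulkGrad (w t)) (bulkGrad v) = 0
  eq_b : ∀ t ∈ Icc 0 T, ∀ (v : H1Bulk Ω) (g : HHalf Ω), IsTrace v (g : L2Surf Ω) →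
    M.ε * inner ℝ (bulkGrad (u t)) (bulkGrad v)
      + M.ε⁻¹ * (∫ x, deriv M.W (bulkFn (u t) x) * bulkFn v x ∂(bulkMeasure Ω))
      - M.ε * (lam t).toFun g = inner ℝ (bulkFn (w t)) (bulkFn v)
  eq_c : ∀ t ∈ Icc 0 T, ∀ (q : H1Surf Ω) (hq : surfFn q ∈ HHalf Ω),
    inner ℝ (derivWithin (fun s => surfFn (p s)) (Icc 0 T) t) (surfFn q)
      + M.δ * M.κ * inner ℝ (surfGrad (p t)) (surfGrad q)
      + M.δ⁻¹ * (∫ x, deriv M.WΓ (surfFn (p t) x) * surfFn q x ∂(surfMeasure Ω))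
      + M.ε * (lam t).toFun ⟨surfFn q, hq⟩ = 0
  eq_d : ∀ t ∈ Icc 0 T, IsTrace (u t) (surfFn (p t))

end CahnHilliard

end

namespace CahnHilliard

/-! ### The surface measure is finite -/

/-! Energy dissipation. Test the first equation of a step with `w'`, the second with `u' - u` and
the third with `p' - p`. The trace of `u' - u` is `p' - p`, so the two multiplier terms cancel. The
gradient terms give `(‖x‖² - ‖y‖²)/2 ≤ ⟨x, x - y⟩`, and the tangent inequalities of the two convex
parts, taken at the new value for `W₊` and at the old one for `W₋`, give `W(u') - W(u) ≤ (W₊'(u') -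
W₋'(u)) (u' - u)`. What remains is `-τσ‖∇w'‖² - ‖p' - p‖²/τ ≤ 0`. The bound also controls `W(u')`
from above by an integrable function. Control from below needs `W₋'(u')` to be integrable, alone and
against `u'`. This comes from the following step of the scheme and from constants being test
functions, for which both measures must be finite; on `Γ` this is where the Lipschitz charts enter
(`integrable_and_integral_le_of_splitting`, `Model.IsStep.hasFiniteEnergy_and_energy_le`).

Accuracy. Let `e_u`, `e_w`, `e_p` be the errors. Mass balance gives a field `G n` with `⟨e_u, v⟩ =
⟨G n, ∇v⟩` for all `v`, obtained by summing fluxes from `G 0 = 0`. Hence `‖G n‖` bounds the dual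
norm of `e_u`, with no elliptic problem to solve, and `‖e_u‖² ≤ ‖G n‖ ‖∇e_u‖`. Subtract the
remaining equations at the new time and test with `e_u`, `e_p`: the multipliers cancel again, so no
regularity of `λ` matters. Moreover `⟨e_w, e_u⟩ = ⟨G (n+1), ∇e_w⟩`, where `τσ∇e_w` is `G n - G
(n+1)` up to a quadrature error of order `τ²`, so this term telescopes. The implicit convex part is
monotone, and the explicit part costs a Lipschitz constant times `τ + ‖e_u‖` at the old time
(`Model.IsStep.error_inequality`). Young's inequality absorbs the `L²` norms
(`error_recursion_of_energy_estimate`), and discrete Gronwall (`add_sum_le_of_implicit_recursion`)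
yields squared errors of order `τ²`. -/

/-- The inequality `≥` holds because the open set `Ω` misses its frontier; `≤` because `y` is a
limit of points of `Ω ∩ U` and the inequality passes to the closure. -/
theorem frontier_inter_subset_graph {d : ℕ} {Ω U : Set (Space d)} {ν : Space d} {ψ : Space d → ℝ}
    (hΩ : IsOpen Ω) (hU : IsOpen U) (hψ : Continuous ψ)
    (h : ∀ y ∈ U, (y ∈ Ω ↔ inner ℝ ν y < ψ (y - (inner ℝ ν y) • ν))) :
    ∀ y ∈ frontier Ω ∩ U, inner ℝ ν y = ψ (y - (inner ℝ ν y) • ν) := by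
  rintro y ⟨hy, hyU⟩
  have hc1 : Continuous fun y : Space d => (inner ℝ ν y : ℝ) := by fun_prop
  have hc2 : Continuous fun y : Space d => ψ (y - (inner ℝ ν y) • ν) :=
    hψ.comp (by fun_prop)
  rw [hΩ.frontier_eq] at hy
  refine le_antisymm ?_ (not_lt.1 fun hlt => hy.2 ((h y hyU).2 hlt))
  have hmem : y ∈ closure (Ω ∩ U) := by
    rw [inter_comm]
    exact hU.inter_closure ⟨hyU, hy.1⟩
  exact closure_minimal (fun z hz => ((h z hz.2).1 hz.1).le) (isClosed_le hc1 hc2) hmem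

/-- The set lies in the image of a ball of the hyperplane `νᗮ` under the Lipschitz map `z ↦ z + ψ z
• ν`. On `νᗮ`, of dimension `d - 1`, the Hausdorff measure is a Haar measure, hence finite on balls.
-/
theorem euclideanHausdorffMeasure_graph_lt_top {d : ℕ} (hd : 1 ≤ d) {ν : Space d} (hν : ‖ν‖ = 1)
    {K : ℝ≥0} {ψ : Space d → ℝ} (hψ : LipschitzWith K ψ) {s : Set (Space d)}
    (hs : Bornology.IsBounded s) (h : ∀ y ∈ s, inner ℝ ν y = ψ (y - (inner ℝ ν y) • ν)) :
    Measure.euclideanHausdorffMeasure (d - 1) s < ⊤ := by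
  obtain ⟨R, hR⟩ := hs.subset_closedBall 0
  have hν0 : ν ≠ 0 := by
    rintro rfl
    simp at hν
  have : Fact (Module.finrank ℝ (Space d) = (d - 1) + 1) := ⟨by simp; omega⟩
  have hfin : Module.finrank ℝ (ℝ ∙ ν)ᗮ = d - 1 :=
    Submodule.finrank_orthogonal_span_singleton hν0
  let F : (ℝ ∙ ν)ᗮ → Space d := fun z => (z : Space d) + ψ z • ν
  have hF : LipschitzWith (1 + K) F := by
    refine (LipschitzWith.subtype_val _).add ?_
    refine LipschitzWith.of_dist_le_mul fun a b => ?_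
    rw [dist_eq_norm, ← sub_smul, norm_smul, hν, mul_one, ← dist_eq_norm]
    exact hψ.dist_le_mul a b
  have hsub : s ⊆ F '' Metric.closedBall 0 (2 * R) := by
    intro y hy
    have hmem : y - (inner ℝ ν y) • ν ∈ (ℝ ∙ ν)ᗮ := by
      rw [Submodule.mem_orthogonal_singleton_iff_inner_right, inner_sub_right, inner_smul_right,
        real_inner_self_eq_norm_sq, hν]
      ring
    refine ⟨⟨_, hmem⟩, ?_, ?_⟩
    · have h1 : ‖y‖ ≤ R := by simpa using hR hy
      have h2 : |(inner ℝ ν y : ℝ)| ≤ ‖y‖ := by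
        simpa [hν] using abs_real_inner_le_norm ν y
      rw [mem_closedBall_zero_iff, Submodule.coe_norm]
      calc ‖y - (inner ℝ ν y : ℝ) • ν‖ ≤ ‖y‖ + ‖(inner ℝ ν y : ℝ) • ν‖ := norm_sub_le _ _
        _ ≤ 2 * R := by
          rw [norm_smul, hν, Real.norm_eq_abs]
          linarith
    · change y - (inner ℝ ν y : ℝ) • ν + ψ (y - (inner ℝ ν y : ℝ) • ν) • ν = y
      rw [← h y hy, sub_add_cancel]
  refine (measure_mono hsub).trans_lt ?_
  rw [Measure.euclideanHausdorffMeasure_def, Measure.smul_apply]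
  refine ENNReal.mul_lt_top (by simp) ?_
  refine (hF.hausdorffMeasure_image_le (by positivity) _).trans_lt ?_
  refine ENNReal.mul_lt_top (ENNReal.rpow_lt_top_of_nonneg (by positivity) (by simp)) ?_
  have hm := isAddHaarMeasure_hausdorffMeasure (E := (ℝ ∙ ν)ᗮ)
  rw [hfin] at hm
  exact Metric.isBounded_closedBall.measure_lt_top

theorem IsBoundedLipschitzDomain.isFiniteMeasure_surfMeasure {d : ℕ} (hd : 1 ≤ d)
    {Ω : Set (Space d)} (hΩ : IsBoundedLipschitzDomain Ω) : IsFiniteMeasure (surfMeasure Ω) := by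
  have hb : Bornology.IsBounded (frontier Ω) :=
    hΩ.isBounded.closure.subset frontier_subset_closure
  have hc : IsCompact (frontier Ω) := Metric.isCompact_of_isClosed_isBounded isClosed_frontier hb
  refine ⟨?_⟩
  rw [surfMeasure, Measure.restrict_apply_univ]
  refine hc.measure_lt_top_of_nhdsWithin fun x hx => ?_
  obtain ⟨U, ν, K, ψ, hU, hxU, hν, hψ, h⟩ := hΩ.lipschitz_boundary x hx
  refine ⟨frontier Ω ∩ U, inter_mem_nhdsWithin _ (hU.mem_nhds hxU), ?_⟩
  exact euclideanHausdorffMeasure_graph_lt_top hd hν hψ (hb.subset inter_subset_left)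
    (frontier_inter_subset_graph hΩ.isOpen hU hψ.continuous h)

theorem IsBoundedLipschitzDomain.isFiniteMeasure_bulkMeasure {d : ℕ}
    {Ω : Set (Space d)} (hΩ : IsBoundedLipschitzDomain Ω) : IsFiniteMeasure (bulkMeasure Ω) := by
  refine ⟨?_⟩
  rw [bulkMeasure, Measure.restrict_apply_univ]
  exact hΩ.isBounded.measure_lt_top

/-! ### Constants are test functions -/

/-- Integration by parts against the constant `1`, one direction `v` at a time. It makes the zero
field a weak gradient of `1`. -/
theorem integral_gradient_eq_zero {d : ℕ} {φ : Space d → ℝ} (hφ : ContDiff ℝ ∞ φ)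
    (hc : HasCompactSupport φ) : ∫ x, gradient φ x = 0 := by
  have h1 : Continuous (gradient φ) :=
    (InnerProductSpace.toDual ℝ (Space d)).symm.continuous.comp
      (hφ.continuous_fderiv (by simp))
  have h2 : HasCompactSupport (gradient φ) :=
    (hc.fderiv (𝕜 := ℝ)).comp_left (g := (InnerProductSpace.toDual ℝ (Space d)).symm) (map_zero _)
  have hi : Integrable (gradient φ) := h1.integrable_of_hasCompactSupport h2
  refine ext_inner_left ℝ fun v => ?_
  rw [← integral_inner hi, inner_zero_right]
  have h3 : ∀ x, inner ℝ v (gradient φ x) = fderiv ℝ φ x v := fun x => by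
    rw [real_inner_comm, gradient, InnerProductSpace.toDual_symm_apply]
  have hiv : Integrable (fun x => fderiv ℝ φ x v) := by
    simpa only [h3] using hi.const_inner (𝕜 := ℝ) v
  have h4 := integral_smul_fderiv_eq_neg_fderiv_smul_of_integrable (μ := volume) (𝕜 := ℝ)
    (f := fun _ : Space d => (1 : ℝ)) (g := φ) (v := v) (by simp)
    (by simpa using hiv) (by simpa using hφ.continuous.integrable_of_hasCompactSupport hc)
    (by simp) (fun x _ => (hφ.differentiable (by simp)) x)
  simpa [h3] using h4

/-- The constant function `1` as an element of `H¹(Ω)`. -/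
theorem exists_bulkFn_eq_one {d : ℕ} (Ω : Set (Space d)) [IsFiniteMeasure (bulkMeasure Ω)] :
    ∃ v : H1Bulk Ω, bulkFn v =ᵐ[bulkMeasure Ω] fun _ => (1 : ℝ) := by
  have h1 : MemLp (fun _ : Space d => (1 : ℝ)) 2 (bulkMeasure Ω) := memLp_const 1
  refine ⟨⟨WithLp.toLp 2 (h1.toLp, 0), ?_⟩, h1.coeFn_toLp⟩
  intro φ hφ hc hs
  have e1 : ∫ x, h1.toLp _ x • gradient φ x ∂(bulkMeasure Ω) = ∫ x, gradient φ x := by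
    have hz : ∀ x, x ∉ Ω → gradient φ x = 0 := fun x hx => by
      rw [gradient, fderiv_of_notMem_tsupport (𝕜 := ℝ) fun h => hx (hs h), map_zero]
    rw [← setIntegral_eq_integral_of_forall_compl_eq_zero hz]
    refine integral_congr_ae ?_
    filter_upwards [h1.coeFn_toLp] with x hx
    rw [hx, one_smul]
  have e2 : ∫ x, φ x • ((0 : L2BulkVec Ω) x) ∂(bulkMeasure Ω) = 0 := by
    refine integral_eq_zero_of_ae ?_
    filter_upwards [Lp.coeFn_zero (Space d) 2 (bulkMeasure Ω)] with x hx
    rw [hx, Pi.zero_apply, smul_zero]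
  change ∫ x, h1.toLp _ x • gradient φ x ∂(bulkMeasure Ω)
    = - ∫ x, φ x • ((0 : L2BulkVec Ω) x) ∂(bulkMeasure Ω)
  rw [e1, e2, integral_gradient_eq_zero hφ hc, neg_zero]

/-- The constant function `1` as an element of `H¹(Γ)`. -/
theorem exists_surfFn_eq_one {d : ℕ} (Ω : Set (Space d)) [IsFiniteMeasure (surfMeasure Ω)] :
    ∃ q : H1Surf Ω, surfFn q =ᵐ[surfMeasure Ω] fun _ => (1 : ℝ) := by
  have h1 : MemLp (fun _ : Space d => (1 : ℝ)) 2 (surfMeasure Ω) := memLp_const 1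
  refine ⟨⟨WithLp.toLp 2 (h1.toLp, 0), ?_⟩, h1.coeFn_toLp⟩
  refine (smoothSurf Ω).le_topologicalClosure ⟨fun _ => 1, contDiff_const, h1.coeFn_toLp, ?_⟩
  filter_upwards [Lp.coeFn_zero (Space d) 2 (surfMeasure Ω)] with x hx
  change (0 : L2SurfVec Ω) x = _
  rw [hx, tangentialGradient, gradient_fun_const, map_zero, Pi.zero_apply]

/-- Test with the constant function `1`. -/
theorem ActsOnBulk.integrable {d : ℕ} {Ω : Set (Space d)} [IsFiniteMeasure (bulkMeasure Ω)]
    {f : Space d → ℝ} (hf : ActsOnBulk Ω f) : Integrable f (bulkMeasure Ω) := by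
  obtain ⟨v, hv⟩ := exists_bulkFn_eq_one Ω
  refine (hf v).congr ?_
  filter_upwards [hv] with x hx
  rw [hx, mul_one]

theorem ActsOnSurf.integrable {d : ℕ} {Ω : Set (Space d)} [IsFiniteMeasure (surfMeasure Ω)]
    {f : Space d → ℝ} (hf : ActsOnSurf Ω f) : Integrable f (surfMeasure Ω) := by
  obtain ⟨v, hv⟩ := exists_surfFn_eq_one Ω
  refine (hf v).congr ?_
  filter_upwards [hv] with x hx
  rw [hx, mul_one]

/-! ### Convex–concave splittings -/

theorem add_deriv_mul_sub_le_of_convexOn {I : Set ℝ} {f : ℝ → ℝ} (hf : ConvexOn ℝ I f)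
    (hI : IsOpen I) (hd : DifferentiableOn ℝ f I) {x y : ℝ} (hx : x ∈ I) (hy : y ∈ I) :
    f x + deriv f x * (y - x) ≤ f y := by
  have h := ((hd x hx).differentiableAt (hI.mem_nhds hx)).hasDerivAt
  rcases lt_trichotomy x y with hxy | rfl | hxy
  · have := hf.le_slope_of_hasDerivAt hx hy hxy h
    rw [slope_def_field, le_div_iff₀ (by linarith)] at this
    linarith
  · simp
  · have := hf.slope_le_of_hasDerivAt hy hx hxy h
    rw [slope_def_field, div_le_iff₀ (by linarith)] at this
    linarith

theorem deriv_sub_mul_sub_nonneg_of_convexOn {I : Set ℝ} {f : ℝ → ℝ} (hf : ConvexOn ℝ I f)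
    (hI : IsOpen I) (hd : DifferentiableOn ℝ f I) {x y : ℝ} (hx : x ∈ I) (hy : y ∈ I) :
    0 ≤ (deriv f x - deriv f y) * (x - y) := by
  have h1 := add_deriv_mul_sub_le_of_convexOn hf hI hd hx hy
  have h2 := add_deriv_mul_sub_le_of_convexOn hf hI hd hy hx
  linarith

/-- Nothing is known about `f` off `I`, so `f` is replaced there by `0`, which changes the
composition only on a null set. -/
theorem aestronglyMeasurable_comp_of_continuousOn {α : Type*} {m : MeasurableSpace α}
    {μ : Measure α} {I : Set ℝ} {f : ℝ → ℝ} {u : α → ℝ} (hI : IsOpen I) (hf : ContinuousOn f I)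
    (hu : AEStronglyMeasurable u μ) (huI : ∀ᵐ x ∂μ, u x ∈ I) :
    AEStronglyMeasurable (fun x => f (u x)) μ := by
  classical
  have hm : Measurable (I.piecewise f 0) :=
    hf.measurable_piecewise continuousOn_const hI.measurableSet
  refine (hm.comp_aemeasurable hu.aemeasurable).aestronglyMeasurable.congr ?_
  filter_upwards [huI] with x hx
  simp [hx]

/-- A convex–concave splitting step keeps the potential energy finite and bounds its increase. -/
theorem integrable_and_integral_le_of_splitting {α : Type*} {m : MeasurableSpace α}
    {μ : Measure α} [IsFiniteMeasure μ] {I : Set ℝ} {f g : ℝ → ℝ} (hI : IsOpen I)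
    (hf : ConvexOn ℝ I f) (hg : ConvexOn ℝ I g) (hfd : DifferentiableOn ℝ f I)
    (hgd : DifferentiableOn ℝ g I) {u u' : α → ℝ} (hu : ∀ᵐ x ∂μ, u x ∈ I)
    (hu' : ∀ᵐ x ∂μ, u' x ∈ I) (hint' : Integrable u' μ)
    (h0 : Integrable (fun x => f (u x) - g (u x)) μ)
    (h1 : Integrable (fun x => (deriv f (u' x) - deriv g (u x)) * (u' x - u x)) μ)
    (h2 : Integrable (fun x => deriv g (u' x)) μ)
    (h3 : Integrable (fun x => deriv g (u' x) * u' x) μ) :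
    Integrable (fun x => f (u' x) - g (u' x)) μ ∧
      ∫ x, (f (u' x) - g (u' x)) ∂μ - ∫ x, (f (u x) - g (u x)) ∂μ
        ≤ ∫ x, (deriv f (u' x) - deriv g (u x)) * (u' x - u x) ∂μ := by
  -- Tangent of `f` at the new value, tangent of `g` at the old value.
  have hub : ∀ᵐ x ∂μ, f (u' x) - g (u' x)
      ≤ (f (u x) - g (u x)) + (deriv f (u' x) - deriv g (u x)) * (u' x - u x) := by
    filter_upwards [hu, hu'] with x hx hx'
    have k1 := add_deriv_mul_sub_le_of_convexOn hf hI hfd hx' hx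
    have k2 := add_deriv_mul_sub_le_of_convexOn hg hI hgd hx hx'
    linarith
  have hint : Integrable (fun x => f (u' x) - g (u' x)) μ := by
    rcases I.eq_empty_or_nonempty with rfl | ⟨c, hc⟩
    · have : μ = 0 := ae_eq_bot.1 (Filter.eventually_false_iff_eq_bot.1 (by simpa using hu))
      rw [this]
      exact integrable_zero_measure
    -- With a fixed `c ∈ I`, `f (u' x)` lies above the tangent of `f` at `c`, and the tangent of `g`
    -- at `u' x`, evaluated at `c`, bounds `g (u' x)` from above. Only `u'`, `deriv g ∘ u'` and
    -- their product appear, all integrable.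
    have hlb : ∀ᵐ x ∂μ, (f c + deriv f c * (u' x - c)) - (g c + deriv g (u' x) * u' x
        - deriv g (u' x) * c) ≤ f (u' x) - g (u' x) := by
      filter_upwards [hu'] with x hx'
      have k1 := add_deriv_mul_sub_le_of_convexOn hf hI hfd hc hx'
      have k2 := add_deriv_mul_sub_le_of_convexOn hg hI hgd hx' hc
      linarith
    refine integrable_of_le_of_le ?_ hlb hub ?_ (h0.add h1)
    · exact aestronglyMeasurable_comp_of_continuousOn (f := fun s => f s - g s) hI
        (hfd.continuousOn.sub hgd.continuousOn) hint'.aestronglyMeasurable hu'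
    · exact (((integrable_const _).add ((hint'.sub (integrable_const _)).const_mul _))).sub
        (((integrable_const _).add h3).sub (h2.mul_const c))
  refine ⟨hint, ?_⟩
  have := integral_mono_ae hint (h0.add h1) hub
  rw [integral_add' h0 h1] at this
  linarith

/-! ### Energy dissipation -/

section Linear

variable {d : ℕ} {Ω : Set (Space d)}

theorem bulkFn_sub (u v : H1Bulk Ω) : bulkFn (u - v) = bulkFn u - bulkFn v := rfl

theorem bulkGrad_sub (u v : H1Bulk Ω) : bulkGrad (u - v) = bulkGrad u - bulkGrad v := rfl

theorem surfFn_sub (p q : H1Surf Ω) : surfFn (p - q) = surfFn p - surfFn q := rfl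

theorem surfGrad_sub (p q : H1Surf Ω) : surfGrad (p - q) = surfGrad p - surfGrad q := rfl

theorem IsTrace.sub {u v : H1Bulk Ω} {p q : H1Surf Ω} (h : IsTrace u (surfFn p))
    (k : IsTrace v (surfFn q)) : IsTrace (u - v) (surfFn (p - q)) :=
  (traceGraph Ω).sub_mem h k

theorem IsTrace.mem_HHalf {u : H1Bulk Ω} {g : L2Surf Ω} (h : IsTrace u g) : g ∈ HHalf Ω :=
  ⟨(u, g), h, rfl⟩

theorem bulkFn_sub_ae (u v : H1Bulk Ω) :
    bulkFn (u - v) =ᵐ[bulkMeasure Ω] fun x => bulkFn u x - bulkFn v x :=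
  Lp.coeFn_sub (bulkFn u) (bulkFn v)

theorem surfFn_sub_ae (p q : H1Surf Ω) :
    surfFn (p - q) =ᵐ[surfMeasure Ω] fun x => surfFn p x - surfFn q x :=
  Lp.coeFn_sub (surfFn p) (surfFn q)

theorem norm_sq_bulk (u : H1Bulk Ω) : ‖u‖ ^ 2 = ‖bulkFn u‖ ^ 2 + ‖bulkGrad u‖ ^ 2 :=
  WithLp.prod_norm_sq_eq_of_L2 u.1

theorem norm_sq_surf (p : H1Surf Ω) : ‖p‖ ^ 2 = ‖surfFn p‖ ^ 2 + ‖surfGrad p‖ ^ 2 :=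
  WithLp.prod_norm_sq_eq_of_L2 p.1

end Linear

theorem integral_quadratic_add {α : Type*} {m : MeasurableSpace α} {μ : Measure α}
    {E : Type*} [NormedAddCommGroup E] [InnerProductSpace ℝ E] (a b : ℝ) (g : Lp E 2 μ)
    {f : α → ℝ} (hf : Integrable f μ) :
    ∫ x, (a * inner ℝ (g x) (g x) + b * f x) ∂μ = a * inner ℝ g g + b * ∫ x, f x ∂μ := by
  rw [integral_add ((L2.integrable_inner g g).const_mul a) (hf.const_mul b),
    integral_const_mul, integral_const_mul, L2.inner_def]

theorem half_mul_inner_sub_le {E : Type*} [NormedAddCommGroup E] [InnerProductSpace ℝ E]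
    (x y : E) : (inner ℝ x x - inner ℝ y y : ℝ) / 2 ≤ inner ℝ x (x - y) := by
  have h : (0 : ℝ) ≤ inner ℝ (x - y) (x - y) := real_inner_self_nonneg
  rw [inner_sub_right] at *
  rw [inner_sub_left, inner_sub_left, real_inner_comm x y] at h
  linarith

/-- The hypotheses `hm`, `hmΓ` concern the concave parts at the new values. The step itself does not
contain them; along a sequence the next step supplies them. -/
theorem Model.IsStep.hasFiniteEnergy_and_energy_le {d : ℕ} {Ω : Set (Space d)}
    [IsFiniteMeasure (bulkMeasure Ω)] [IsFiniteMeasure (surfMeasure Ω)] {M : Model} {τ : ℝ}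
    (hτ : 0 < τ) {u u' w' : H1Bulk Ω} {p p' : H1Surf Ω} {lam' : HNegHalf Ω}
    (h : M.IsStep τ u p u' w' p' lam') (htr : IsTrace u (surfFn p))
    (hE : M.HasFiniteEnergy u p) (hm : ActsOnBulk Ω (fun x => deriv M.Wm (bulkFn u' x)))
    (hmΓ : ActsOnSurf Ω (fun x => deriv M.WΓm (surfFn p' x))) :
    M.HasFiniteEnergy u' p' ∧ M.energy u' p' ≤ M.energy u p := by
  have hI : ∀ v : H1Bulk Ω, Integrable
      (fun x => (deriv M.Wp (bulkFn u' x) - deriv M.Wm (bulkFn u x)) * bulkFn v x)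
      (bulkMeasure Ω) := fun v =>
    ((h.acts_Wp v).sub (h.acts_Wm v)).congr (.of_forall fun x => (sub_mul _ _ _).symm)
  have hIΓ : ∀ q : H1Surf Ω, Integrable
      (fun x => (deriv M.WΓp (surfFn p' x) - deriv M.WΓm (surfFn p x)) * surfFn q x)
      (surfMeasure Ω) := fun q =>
    ((h.acts_WΓp q).sub (h.acts_WΓm q)).congr (.of_forall fun x => (sub_mul _ _ _).symm)
  have e1 : (fun x => (deriv M.Wp (bulkFn u' x) - deriv M.Wm (bulkFn u x)) * bulkFn (u' - u) x)
      =ᵐ[bulkMeasure Ω] fun x => (deriv M.Wp (bulkFn u' x) - deriv M.Wm (bulkFn u x))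
        * (bulkFn u' x - bulkFn u x) := by
    filter_upwards [bulkFn_sub_ae u' u] with x hx
    rw [hx]
  have e2 : (fun x => (deriv M.WΓp (surfFn p' x) - deriv M.WΓm (surfFn p x))
      * surfFn (p' - p) x) =ᵐ[surfMeasure Ω] fun x =>
        (deriv M.WΓp (surfFn p' x) - deriv M.WΓm (surfFn p x))
        * (surfFn p' x - surfFn p x) := by
    filter_upwards [surfFn_sub_ae p' p] with x hx
    rw [hx]
  obtain ⟨hint, hle⟩ := integrable_and_integral_le_of_splitting M.isOpen_I M.convex_Wp
    M.convex_Wm M.diff_Wp M.diff_Wm h.values.1 h.values'.1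
    ((Lp.memLp (bulkFn u')).integrable (by norm_num)) hE.1 ((hI _).congr e1) hm.integrable (hm u')
  obtain ⟨hintΓ, hleΓ⟩ := integrable_and_integral_le_of_splitting M.isOpen_IΓ M.convex_WΓp
    M.convex_WΓm M.diff_WΓp M.diff_WΓm h.values.2 h.values'.2
    ((Lp.memLp (surfFn p')).integrable (by norm_num)) hE.2 ((hIΓ _).congr e2) hmΓ.integrable
    (hmΓ p')
  refine ⟨⟨hint, hintΓ⟩, ?_⟩
  rw [← integral_congr_ae e1] at hle
  rw [← integral_congr_ae e2] at hleΓ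
  have htr' := h.eq_d.sub htr
  have ha := h.eq_a w'
  have hb := h.eq_b (u' - u) ⟨_, htr'.mem_HHalf⟩ htr'
  have hc := h.eq_c (p' - p) htr'.mem_HHalf
  simp only [Model.energy, Model.bulkEnergy, Model.surfEnergy]
  rw [integral_quadratic_add _ _ _ (f := fun x => M.W (bulkFn u' x)) hint,
    integral_quadratic_add _ _ _ (f := fun x => M.W (bulkFn u x)) hE.1,
    integral_quadratic_add _ _ _ (f := fun x => M.WΓ (surfFn p' x)) hintΓ,
    integral_quadratic_add _ _ _ (f := fun x => M.WΓ (surfFn p x)) hE.2]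
  have g1 := half_mul_inner_sub_le (bulkGrad u') (bulkGrad u)
  have g2 := half_mul_inner_sub_le (surfGrad p') (surfGrad p)
  rw [← bulkGrad_sub] at g1
  rw [← surfGrad_sub] at g2
  -- The first equation tested with `w'`: the left side is `-τσ‖∇w'‖²`.
  have hw : (inner ℝ (bulkFn w') (bulkFn (u' - u)) : ℝ) ≤ 0 := by
    rw [bulkFn_sub, inner_sub_right, real_inner_comm, real_inner_comm (bulkFn u)]
    have : 0 ≤ τ * M.σ * inner ℝ (bulkGrad w') (bulkGrad w') :=
      mul_nonneg (mul_pos hτ M.σ_pos).le real_inner_self_nonneg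
    linarith
  have hp : (0 : ℝ) ≤ inner ℝ (surfFn p') (surfFn (p' - p))
      - inner ℝ (surfFn p) (surfFn (p' - p)) := by
    rw [← inner_sub_left, ← surfFn_sub]
    exact real_inner_self_nonneg
  -- The third equation tested with `p' - p` and divided by `τ`, with `‖p' - p‖² ≥ 0` dropped.
  have hc' : M.δ * M.κ * inner ℝ (surfGrad p') (surfGrad (p' - p))
      + M.δ⁻¹ * (∫ x, (deriv M.WΓp (surfFn p' x) - deriv M.WΓm (surfFn p x))
        * surfFn (p' - p) x ∂(surfMeasure Ω))
      + M.ε * lam'.toFun ⟨surfFn (p' - p), htr'.mem_HHalf⟩ ≤ 0 := by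
    refine nonpos_of_mul_nonpos_right ?_ hτ
    linarith
  have k1 := mul_le_mul_of_nonneg_left g1 M.ε_pos.le
  have k2 := mul_le_mul_of_nonneg_left g2 (mul_pos M.δ_pos M.κ_pos).le
  have k3 := mul_le_mul_of_nonneg_left hle (inv_pos.2 M.ε_pos).le
  have k4 := mul_le_mul_of_nonneg_left hleΓ (inv_pos.2 M.δ_pos).le
  simp only [Model.W, Model.WΓ]
  linarith

theorem Model.energy_dissipation {d : ℕ} {Ω : Set (Space d)}
    [IsFiniteMeasure (bulkMeasure Ω)] [IsFiniteMeasure (surfMeasure Ω)] {M : Model} {τ : ℝ}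
    (hτ : 0 < τ) {u w : ℕ → H1Bulk Ω} {p : ℕ → H1Surf Ω} {lam : ℕ → HNegHalf Ω}
    (htr : IsTrace (u 0) (surfFn (p 0))) (hE : M.HasFiniteEnergy (u 0) (p 0))
    (h : ∀ n, M.IsStep τ (u n) (p n) (u (n + 1)) (w (n + 1)) (p (n + 1)) (lam (n + 1)))
    (n : ℕ) : IsTrace (u n) (surfFn (p n)) ∧ M.HasFiniteEnergy (u n) (p n) ∧
      M.energy (u (n + 1)) (p (n + 1)) ≤ M.energy (u n) (p n) := by
  have htr' : ∀ n, IsTrace (u n) (surfFn (p n)) := fun n => by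
    cases n with
    | zero => exact htr
    | succ n => exact (h n).eq_d
  -- Step `n + 1` is used here only for the integrability of the concave parts at the values
  -- produced by step `n`.
  have step := fun n hn => (h n).hasFiniteEnergy_and_energy_le hτ (htr' n) hn (h (n + 1)).acts_Wm
    (h (n + 1)).acts_WΓm
  have hfin : ∀ n, M.HasFiniteEnergy (u n) (p n) := fun n => by
    induction n with
    | zero => exact hE
    | succ n ih => exact (step n ih).1
  exact ⟨htr' n, hfin n, (step n (hfin n)).2⟩

/-! ### Discrete Gronwall inequality -/

/-- A discrete Gronwall inequality for an implicit recursion with dissipation `B` and a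
consistency error of third order in the step size. -/
theorem add_sum_le_of_implicit_recursion {A B : ℕ → ℝ} {K D T τ : ℝ} {N : ℕ} (hK : 0 ≤ K)
    (hD : 0 ≤ D) (hτ : 0 < τ) (hKτ : K * τ ≤ 1 / 2) (hN : N * τ ≤ T) (hA0 : A 0 = 0)
    (hB : ∀ n, 0 ≤ B n)
    (h : ∀ n < N, A (n + 1) + τ * B (n + 1) ≤ A n + K * τ * (A n + A (n + 1)) + D * τ ^ 3) :
    ∀ n ≤ N, A n + ∑ k ∈ Finset.Icc 1 n, τ * B k ≤ 2 * D * T * Real.exp (4 * K * T) * τ ^ 2 := by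
  have key : ∀ n ≤ N, A n + ∑ k ∈ Finset.Icc 1 n, τ * B k
      ≤ Real.exp (4 * K * (n * τ)) * (2 * D * τ ^ 3 * n) := by
    intro n
    induction n with
    | zero => intro _; simp [hA0]
    | succ n ih =>
      intro hn
      have ih := ih (by omega)
      have hs := h n (by omega)
      rw [Finset.sum_Icc_succ_top (by omega)]
      set Q := ∑ k ∈ Finset.Icc 1 n, τ * B k with hQ
      have hQ0 : 0 ≤ Q := Finset.sum_nonneg fun k _ => mul_nonneg hτ.le (hB k)
      have hb := mul_nonneg hτ.le (hB (n + 1))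
      have hKt : 0 ≤ K * τ := mul_nonneg hK hτ.le
      set S := A n + Q with hS
      set S' := A (n + 1) + (Q + τ * B (n + 1)) with hS'
      have hd : 0 ≤ D * τ ^ 3 := by positivity
      -- Adding the accumulated dissipation to both `A n` and `A (n + 1)` preserves the recursion,
      -- since the extra terms on the right are nonnegative.
      have h1 : (1 - K * τ) * S' ≤ (1 + K * τ) * S + D * τ ^ 3 := by
        have e1 := mul_nonneg hKt hQ0
        have e2 := mul_nonneg hKt hb
        simp only [hS, hS']
        nlinarith
      set R := Real.exp (4 * K * (n * τ)) * (2 * D * τ ^ 3 * n) with hR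
      have hR0 : 0 ≤ R := by positivity
      -- For `x = K * τ ≤ 1/2` one has `1 + x ≤ (1 - x)(1 + 4x)` and `1 ≤ 2(1 - x)`; hence the `4`
      -- in the exponent and the `2` before `D`.
      have h2 : (1 - K * τ) * S' ≤ (1 - K * τ) * ((1 + 4 * (K * τ)) * R + 2 * (D * τ ^ 3)) := by
        have e1 : (1 + K * τ) * S ≤ (1 + K * τ) * R := by gcongr
        have e2 : 0 ≤ (1 / 2 - K * τ) * (K * τ * R) :=
          mul_nonneg (by linarith) (mul_nonneg hKt hR0)
        have e3 : 0 ≤ (1 / 2 - K * τ) * (D * τ ^ 3) := mul_nonneg (by linarith) hd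
        linarith
      have h3 := le_of_mul_le_mul_left h2 (by linarith)
      refine h3.trans ?_
      have e1 : 1 + 4 * (K * τ) ≤ Real.exp (4 * (K * τ)) := by
        linarith [Real.add_one_le_exp (4 * (K * τ))]
      have e2 : Real.exp (4 * K * ((n + 1 : ℕ) * τ))
          = Real.exp (4 * (K * τ)) * Real.exp (4 * K * (n * τ)) := by
        rw [← Real.exp_add]
        congr 1
        push_cast
        ring
      have e3 : 1 ≤ Real.exp (4 * K * ((n + 1 : ℕ) * τ)) := Real.one_le_exp (by positivity)
      calc (1 + 4 * (K * τ)) * R + 2 * (D * τ ^ 3)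
          ≤ Real.exp (4 * (K * τ)) * R
            + Real.exp (4 * K * ((n + 1 : ℕ) * τ)) * (2 * (D * τ ^ 3)) := by
            have := mul_le_mul_of_nonneg_right e3 (show 0 ≤ 2 * (D * τ ^ 3) by positivity)
            have := mul_le_mul_of_nonneg_right e1 hR0
            linarith
        _ = Real.exp (4 * K * ((n + 1 : ℕ) * τ)) * (2 * D * τ ^ 3 * (n + 1 : ℕ)) := by
            rw [hR, e2]
            push_cast
            ring
  intro n hn
  refine (key n hn).trans ?_
  have hnT : n * τ ≤ T := le_trans (by gcongr) hN
  calc Real.exp (4 * K * (n * τ)) * (2 * D * τ ^ 3 * n)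
      = Real.exp (4 * K * (n * τ)) * (n * τ) * (2 * D * τ ^ 2) := by ring
    _ ≤ Real.exp (4 * K * T) * T * (2 * D * τ ^ 2) := by gcongr
    _ = _ := by ring

/-! ### Consistency errors -/

theorem exists_norm_sub_le_of_contDiffOn {E : Type*} [NormedAddCommGroup E] [NormedSpace ℝ E]
    {f : ℝ → E} {T : ℝ} (hf : ContDiffOn ℝ 1 f (Icc 0 T)) :
    ∃ K : ℝ, 0 ≤ K ∧ ∀ s ∈ Icc 0 T, ∀ t ∈ Icc 0 T, ‖f t - f s‖ ≤ K * |t - s| := by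
  obtain ⟨K, hK⟩ := hf.exists_lipschitzOnWith one_ne_zero (convex_Icc 0 T) isCompact_Icc
  refine ⟨K, K.2, fun s hs t ht => ?_⟩
  simpa [dist_eq_norm] using hK.dist_le_mul t ht s hs

/-- Second-order Taylor estimate for a `C²` function, expanded at the right end point. -/
theorem exists_norm_sub_sub_smul_derivWithin_le {E : Type*} [NormedAddCommGroup E]
    [NormedSpace ℝ E] {f : ℝ → E} {T : ℝ} (hT : 0 < T) (hf : ContDiffOn ℝ 2 f (Icc 0 T)) :
    ∃ K : ℝ, 0 ≤ K ∧ ∀ s ∈ Icc 0 T, ∀ t ∈ Icc 0 T, s ≤ t →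
      ‖f t - f s - (t - s) • derivWithin f (Icc 0 T) t‖ ≤ K * (t - s) ^ 2 := by
  have hu : UniqueDiffOn ℝ (Icc 0 T) := uniqueDiffOn_Icc hT
  obtain ⟨K, hK0, hK⟩ := exists_norm_sub_le_of_contDiffOn
    (hf.derivWithin hu (m := 1) (by norm_num))
  refine ⟨K, hK0, fun s hs t ht hst => ?_⟩
  set c := derivWithin f (Icc 0 T) t with hc
  have hsub : Icc s t ⊆ Icc 0 T := Icc_subset_Icc hs.1 ht.2
  -- Mean value inequality for `f r - r • f'(t)`, whose derivative `f'(r) - f'(t)` is at most `K *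
  -- (t - s)` in norm.
  have hd : ∀ r ∈ Icc s t, HasDerivWithinAt (fun r => f r - r • c)
      (derivWithin f (Icc 0 T) r - (1 : ℝ) • c) (Icc s t) r := fun r hr =>
    (((hf.differentiableOn (by norm_num)) r (hsub hr)).hasDerivWithinAt.mono hsub).sub
      ((hasDerivWithinAt_id r _).smul_const c)
  have hb : ∀ r ∈ Icc s t, ‖derivWithin f (Icc 0 T) r - (1 : ℝ) • c‖ ≤ K * (t - s) := by
    intro r hr
    rw [one_smul]
    refine (hK t ht r (hsub hr)).trans ?_
    gcongr
    rw [abs_sub_comm, abs_of_nonneg (by linarith [hr.2])]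
    linarith [hr.1]
  have := (convex_Icc s t).norm_image_sub_le_of_norm_hasDerivWithin_le hd hb
    (left_mem_Icc.2 hst) (right_mem_Icc.2 hst)
  rw [Real.norm_of_nonneg (by linarith)] at this
  calc ‖f t - f s - (t - s) • c‖ = ‖f t - t • c - (f s - s • c)‖ := by
        congr 1
        rw [sub_smul]
        abel
    _ ≤ K * (t - s) ^ 2 := by rw [sq, ← mul_assoc]; exact this

/-- The error of the right-end rectangle rule. Applied to `∇w`, it is the only consistency error in
the mass balance. -/
theorem norm_integral_sub_smul_le {E : Type*} [NormedAddCommGroup E] [NormedSpace ℝ E]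
    [CompleteSpace E] {g : ℝ → E} {T K s t : ℝ} (hg : ContinuousOn g (Icc 0 T)) (hK : 0 ≤ K)
    (hL : ∀ s ∈ Icc 0 T, ∀ t ∈ Icc 0 T, ‖g t - g s‖ ≤ K * |t - s|)
    (hs : s ∈ Icc 0 T) (ht : t ∈ Icc 0 T) (hst : s ≤ t) :
    ‖(∫ r in s..t, g r) - (t - s) • g t‖ ≤ K * (t - s) ^ 2 := by
  have hsub : Icc s t ⊆ Icc 0 T := Icc_subset_Icc hs.1 ht.2
  have hi : IntervalIntegrable g volume s t := by
    refine ContinuousOn.intervalIntegrable ?_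
    rw [uIcc_of_le hst]
    exact hg.mono hsub
  rw [← intervalIntegral.integral_const, ← intervalIntegral.integral_sub hi (by simp)]
  refine (intervalIntegral.norm_integral_le_of_norm_le_const (C := K * (t - s)) ?_).trans ?_
  · intro r hr
    rw [uIoc_of_le hst] at hr
    refine (hL t ht r (hsub (Ioc_subset_Icc_self hr))).trans ?_
    gcongr
    rw [abs_sub_comm, abs_of_nonneg (by linarith [hr.2])]
    linarith [hr.1]
  · rw [abs_of_nonneg (by linarith)]
    exact le_of_eq (by ring)

/-- The mass balance integrated exactly in time by the fundamental theorem of calculus. No Taylor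
expansion of `u` is made, so one derivative of `u` and a Lipschitz `w` suffice. -/
theorem inner_sub_eq_inner_integral_of_derivWithin {H H' : Type*} [NormedAddCommGroup H]
    [InnerProductSpace ℝ H] [NormedAddCommGroup H'] [InnerProductSpace ℝ H'] [CompleteSpace H']
    {f : ℝ → H} {g : ℝ → H'} {T s t σ : ℝ} {x : H} {y : H'} (hf : ContDiffOn ℝ 1 f (Icc 0 T))
    (hg : ContinuousOn g (Icc 0 T)) (hs : s ∈ Icc 0 T) (ht : t ∈ Icc 0 T) (hst : s ≤ t)
    (h : ∀ r ∈ Icc 0 T, inner ℝ (derivWithin f (Icc 0 T) r) x + σ * inner ℝ (g r) y = 0) :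
    (inner ℝ (f t - f s) x : ℝ) = - σ * inner ℝ (∫ r in s..t, g r) y := by
  have hsub : Icc s t ⊆ Icc 0 T := Icc_subset_Icc hs.1 ht.2
  have hi : IntervalIntegrable g volume s t := by
    refine ContinuousOn.intervalIntegrable ?_
    rw [uIcc_of_le hst]
    exact hg.mono hsub
  have e1 : (inner ℝ (∫ r in s..t, g r) y : ℝ) = ∫ r in s..t, inner ℝ (g r) y := by
    have := (innerSL ℝ y).intervalIntegral_comp_comm hi
    simp only [innerSL_apply_apply] at this
    simp only [real_inner_comm y]
    exact this.symm
  have hder : ∀ r ∈ Ioo s t, HasDerivAt (fun r => (inner ℝ (f r) x : ℝ))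
      (- σ * inner ℝ (g r) y) r := by
    intro r hr
    have hr' : r ∈ Icc 0 T := hsub (Ioo_subset_Icc_self hr)
    have hn : Icc 0 T ∈ nhds r := Icc_mem_nhds (hs.1.trans_lt hr.1) (hr.2.trans_le ht.2)
    have h1 := ((hf.differentiableOn one_ne_zero) r hr').hasDerivWithinAt.hasDerivAt hn
    have h2 := h1.inner ℝ (hasDerivAt_const r x)
    rw [inner_zero_right, zero_add] at h2
    rwa [show - σ * inner ℝ (g r) y = inner ℝ (derivWithin f (Icc 0 T) r) x by
      linarith [h r hr']]
  have hc : ContinuousOn (fun r => - σ * (inner ℝ (g r) y : ℝ)) (Icc s t) :=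
    continuousOn_const.mul ((hg.mono hsub).inner continuousOn_const)
  have h3 := intervalIntegral.integral_eq_sub_of_hasDerivAt_of_le hst
    ((hf.continuousOn.mono hsub).inner continuousOn_const) hder
    (ContinuousOn.intervalIntegrable (by rwa [uIcc_of_le hst]))
  rw [intervalIntegral.integral_const_mul, ← e1] at h3
  rw [inner_sub_left, h3]

/-! ### Stability of the splitting -/

theorem integral_abs_mul_abs_le {α : Type*} {m : MeasurableSpace α} {μ : Measure α}
    (f g : Lp ℝ 2 μ) :
    Integrable (fun x => |f x| * |g x|) μ ∧ ∫ x, |f x| * |g x| ∂μ ≤ ‖f‖ * ‖g‖ := by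
  have e : (fun x => inner ℝ ((|f| : Lp ℝ 2 μ) x) ((|g| : Lp ℝ 2 μ) x))
      =ᵐ[μ] fun x => |f x| * |g x| := by
    filter_upwards [Lp.coeFn_abs f, Lp.coeFn_abs g] with x hx hy
    rw [hx, hy, real_inner_eq_re_inner, RCLike.inner_apply]
    simp [mul_comm]
  refine ⟨(L2.integrable_inner _ _).congr e, ?_⟩
  rw [← integral_congr_ae e, ← L2.inner_def, ← norm_abs_eq_norm f, ← norm_abs_eq_norm g]
  exact real_inner_le_norm _ _

/-- The difference of the nonlinear terms at the exact solution `a` and at the splitting step from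
`c` to `b`, tested with the error `a - b`, is bounded below by the Lipschitz error of the
explicit part. -/
theorem le_integral_sub_integral_of_splitting {α : Type*} {m : MeasurableSpace α}
    {μ : Measure α} {I J : Set ℝ} {f g : ℝ → ℝ} {L : ℝ≥0} (hI : IsOpen I) (hJ : J ⊆ I)
    (hf : ConvexOn ℝ I f) (hfd : DifferentiableOn ℝ f I) (hgd : DifferentiableOn ℝ g I)
    (hL : LipschitzOnWith L (deriv g) J) {a b c e : Lp ℝ 2 μ} (he : e = a - b)
    (ha : ∀ᵐ x ∂μ, a x ∈ J) (hb : ∀ᵐ x ∂μ, b x ∈ J) (hc : ∀ᵐ x ∂μ, c x ∈ J)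
    (h1 : Integrable (fun x => deriv (fun s => f s - g s) (a x) * e x) μ)
    (h2 : Integrable (fun x => (deriv f (b x) - deriv g (c x)) * e x) μ) :
    - (L * (‖a - c‖ * ‖e‖)) ≤ ∫ x, deriv (fun s => f s - g s) (a x) * e x ∂μ
      - ∫ x, (deriv f (b x) - deriv g (c x)) * e x ∂μ := by
  obtain ⟨i1, i2⟩ := integral_abs_mul_abs_le (a - c) e
  rw [← integral_sub h1 h2]
  have h3 : ∫ x, - (L * (|(a - c) x| * |e x|)) ∂μ
      ≤ ∫ x, (deriv (fun s => f s - g s) (a x) * e x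
        - (deriv f (b x) - deriv g (c x)) * e x) ∂μ := by
    refine integral_mono_ae (i1.const_mul _).neg (h1.sub h2) ?_
    have hex := Lp.coeFn_sub a b
    rw [← he] at hex
    filter_upwards [ha, hb, hc, hex, Lp.coeFn_sub a c] with x hax hbx hcx hx hy
    have hd : deriv (fun s => f s - g s) (a x) = deriv f (a x) - deriv g (a x) :=
      deriv_fun_sub ((hfd _ (hJ hax)).differentiableAt (hI.mem_nhds (hJ hax)))
        ((hgd _ (hJ hax)).differentiableAt (hI.mem_nhds (hJ hax)))
    have k1 := deriv_sub_mul_sub_nonneg_of_convexOn hf hI hfd (hJ hax) (hJ hbx)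
    have k2 : |deriv g (a x) - deriv g (c x)| ≤ L * |a x - c x| := by
      simpa [Real.dist_eq] using hL.dist_le_mul _ hax _ hcx
    have k3 : (deriv g (a x) - deriv g (c x)) * e x ≤ L * |a x - c x| * |e x| :=
      (le_abs_self _).trans (by rw [abs_mul]; gcongr)
    rw [Pi.sub_apply] at hx hy
    rw [hd, hy]
    rw [hx] at k3 ⊢
    linarith
  rw [integral_neg, integral_const_mul] at h3
  refine le_trans ?_ h3
  gcongr

/-! ### Error estimate -/

/-- The implicit Euler inequality: increments tested at the new time telescope. -/
theorem half_sub_norm_sq_le_inner_sub_self {E : Type*} [NormedAddCommGroup E] [InnerProductSpace ℝ E] (x y : E) :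
    (‖x‖ ^ 2 - ‖y‖ ^ 2) / 2 ≤ inner ℝ (x - y) x := by
  have h := half_mul_inner_sub_le x y
  rwa [real_inner_self_eq_norm_sq, real_inner_self_eq_norm_sq, real_inner_comm] at h

/-- The energy estimate for the error of one step. The field `G'` represents the error of `u` in
`H¹(Ω)*` through `v ↦ ∫ G' · ∇v`. -/
theorem Model.IsStep.error_inequality {d : ℕ} {Ω : Set (Space d)} {M : Model} {T τ : ℝ}
    (hτ : 0 < τ) {u w : ℝ → H1Bulk Ω} {p : ℝ → H1Surf Ω} {lam : ℝ → HNegHalf Ω}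
    (hsol : M.IsRegularSolution T u w p lam) {J JΓ : Set ℝ} (hJ : J ⊆ M.I) (hJΓ : JΓ ⊆ M.IΓ)
    {L LΓ : ℝ≥0} (hL : LipschitzOnWith L (deriv M.Wm) J)
    (hLΓ : LipschitzOnWith LΓ (deriv M.WΓm) JΓ) {Ku Kp Kd Kw s t : ℝ}
    (ht : t ∈ Icc 0 T) (hKu : ‖bulkFn (u t) - bulkFn (u s)‖ ≤ Ku * τ)
    (hKp : ‖surfFn (p t) - surfFn (p s)‖ ≤ Kp * τ)
    (hKd : ‖surfFn (p t) - surfFn (p s)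
      - τ • derivWithin (fun r => surfFn (p r)) (Icc 0 T) t‖ ≤ Kd * τ ^ 2)
    {U U' V' : H1Bulk Ω} {P P' : H1Surf Ω} {Λ' : HNegHalf Ω} {ρ G G' : L2BulkVec Ω}
    (hρ : ‖ρ‖ ≤ Kw * τ ^ 2) (hG : G' = G - M.σ • (ρ + τ • bulkGrad (w t - V')))
    (hG' : ∀ v, inner ℝ (bulkFn (u t - U')) (bulkFn v) = inner ℝ G' (bulkGrad v))
    (hval : ValuesIn (u t) (p t) J JΓ) (hU : ValuesIn U P J JΓ) (hU' : ValuesIn U' P' J JΓ)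
    (hstep : M.IsStep τ U P U' V' P' Λ') :
    τ * M.ε * ‖bulkGrad (u t - U')‖ ^ 2 + τ * (M.δ * M.κ) * ‖surfGrad (p t - P')‖ ^ 2
      + (‖G'‖ ^ 2 - ‖G‖ ^ 2) / (2 * M.σ)
      + (‖surfFn (p t - P')‖ ^ 2 - ‖surfFn (p s - P)‖ ^ 2) / 2
    ≤ τ * (M.ε⁻¹ * L) * ((Ku * τ + ‖bulkFn (u s - U)‖) * ‖bulkFn (u t - U')‖)
      + τ * (M.δ⁻¹ * LΓ) * ((Kp * τ + ‖surfFn (p s - P)‖) * ‖surfFn (p t - P')‖)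
      + Kd * τ ^ 2 * ‖surfFn (p t - P')‖ + ‖G'‖ * (Kw * τ ^ 2) := by
  have hε := M.ε_pos
  have hσ := M.σ_pos
  have hδ := M.δ_pos
  have htr := (hsol.eq_d t ht).sub hstep.eq_d
  have hb1 := hsol.eq_b t ht (u t - U') ⟨_, htr.mem_HHalf⟩ htr
  have hb2 := hstep.eq_b (u t - U') ⟨_, htr.mem_HHalf⟩ htr
  have hc1 := hsol.eq_c t ht (p t - P') htr.mem_HHalf
  have hc2 := hstep.eq_c (p t - P') htr.mem_HHalf
  have hI : Integrable (fun x => (deriv M.Wp (bulkFn U' x) - deriv M.Wm (bulkFn U x))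
      * bulkFn (u t - U') x) (bulkMeasure Ω) :=
    ((hstep.acts_Wp _).sub (hstep.acts_Wm _)).congr (.of_forall fun x => (sub_mul _ _ _).symm)
  have hIΓ : Integrable (fun x => (deriv M.WΓp (surfFn P' x) - deriv M.WΓm (surfFn P x))
      * surfFn (p t - P') x) (surfMeasure Ω) :=
    ((hstep.acts_WΓp _).sub (hstep.acts_WΓm _)).congr (.of_forall fun x => (sub_mul _ _ _).symm)
  have m1 := le_integral_sub_integral_of_splitting M.isOpen_I hJ M.convex_Wp M.diff_Wp M.diff_Wm
    hL (bulkFn_sub (u t) U') hval.1 hU'.1 hU.1 (hsol.acts_W t ht _) hI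
  have m2 := le_integral_sub_integral_of_splitting M.isOpen_IΓ hJΓ M.convex_WΓp M.diff_WΓp
    M.diff_WΓm hLΓ (surfFn_sub (p t) P') hval.2 hU'.2 hU.2 (hsol.acts_WΓ t ht _) hIΓ
  -- The explicit term compares the exact solution at the new time `t` with the iterate at the old
  -- time; inserting `u s` separates the time increment from the old error.
  have n1 : ‖bulkFn (u t) - bulkFn U‖ ≤ Ku * τ + ‖bulkFn (u s - U)‖ :=
    (norm_sub_le_norm_sub_add_norm_sub _ (bulkFn (u s)) _).trans (by rw [bulkFn_sub]; gcongr)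
  have n2 : ‖surfFn (p t) - surfFn P‖ ≤ Kp * τ + ‖surfFn (p s - P)‖ :=
    (norm_sub_le_norm_sub_add_norm_sub _ (surfFn (p s)) _).trans (by rw [surfFn_sub]; gcongr)
  have k1 := mul_le_mul_of_nonneg_left (mul_le_mul_of_nonneg_right n1
    (norm_nonneg (bulkFn (u t - U')))) L.coe_nonneg
  have k2 := mul_le_mul_of_nonneg_left (mul_le_mul_of_nonneg_right n2
    (norm_nonneg (surfFn (p t - P')))) LΓ.coe_nonneg
  set I1 := ∫ x, deriv (fun s => M.Wp s - M.Wm s) (bulkFn (u t) x) * bulkFn (u t - U') x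
    ∂(bulkMeasure Ω) with hI1
  set I2 := ∫ x, (deriv M.Wp (bulkFn U' x) - deriv M.Wm (bulkFn U x)) * bulkFn (u t - U') x
    ∂(bulkMeasure Ω)
  set I3 := ∫ x, deriv (fun s => M.WΓp s - M.WΓm s) (surfFn (p t) x) * surfFn (p t - P') x
    ∂(surfMeasure Ω) with hI3
  set I4 := ∫ x, (deriv M.WΓp (surfFn P' x) - deriv M.WΓm (surfFn P x)) * surfFn (p t - P') x
    ∂(surfMeasure Ω)
  rw [show M.W = fun s => M.Wp s - M.Wm s from rfl, ← hI1] at hb1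
  rw [show M.WΓ = fun s => M.WΓp s - M.WΓm s from rfl, ← hI3] at hc1
  have q1 : (inner ℝ (bulkGrad (u t)) (bulkGrad (u t - U'))
      - inner ℝ (bulkGrad U') (bulkGrad (u t - U')) : ℝ) = ‖bulkGrad (u t - U')‖ ^ 2 := by
    rw [← inner_sub_left, ← bulkGrad_sub, real_inner_self_eq_norm_sq]
  have q2 : (inner ℝ (surfGrad (p t)) (surfGrad (p t - P'))
      - inner ℝ (surfGrad P') (surfGrad (p t - P')) : ℝ) = ‖surfGrad (p t - P')‖ ^ 2 := by
    rw [← inner_sub_left, ← surfGrad_sub, real_inner_self_eq_norm_sq]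
  -- By `hG'` with `v = w t - V'`, the coupling of `e_w` and `e_u` becomes a pairing of `G'` with
  -- `∇e_w`.
  have q3 : (inner ℝ (bulkFn (w t)) (bulkFn (u t - U'))
      - inner ℝ (bulkFn V') (bulkFn (u t - U')) : ℝ) = inner ℝ G' (bulkGrad (w t - V')) := by
    rw [← inner_sub_left, ← bulkFn_sub, real_inner_comm, hG']
  -- Here `τσ∇e_w = G - G' - σρ`, so the pairing with `G'` is a telescoping term plus the quadrature
  -- error.
  have q4 : τ * M.σ * inner ℝ G' (bulkGrad (w t - V'))
      ≤ - ((‖G'‖ ^ 2 - ‖G‖ ^ 2) / 2) + M.σ * (‖G'‖ * (Kw * τ ^ 2)) := by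
    have e1 := half_sub_norm_sq_le_inner_sub_self G' G
    have e2 : G' - G = - (M.σ • (ρ + τ • bulkGrad (w t - V'))) := by rw [hG]; abel
    rw [e2, inner_neg_left, inner_smul_left, inner_add_left, inner_smul_left] at e1
    simp only [RCLike.conj_to_real] at e1
    rw [real_inner_comm G' (bulkGrad (w t - V'))] at e1
    have e3 : -(inner ℝ ρ G' : ℝ) ≤ ‖G'‖ * (Kw * τ ^ 2) := by
      refine (neg_le_abs _).trans ((abs_real_inner_le_norm _ _).trans ?_)
      rw [mul_comm]
      gcongr
    have e4 := mul_le_mul_of_nonneg_left e3 hσ.le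
    linarith
  have q4' : τ * inner ℝ G' (bulkGrad (w t - V'))
      ≤ - ((‖G'‖ ^ 2 - ‖G‖ ^ 2) / (2 * M.σ)) + ‖G'‖ * (Kw * τ ^ 2) := by
    refine le_of_mul_le_mul_left ?_ hσ
    have e : M.σ * ((‖G'‖ ^ 2 - ‖G‖ ^ 2) / (2 * M.σ)) = (‖G'‖ ^ 2 - ‖G‖ ^ 2) / 2 := by
      field_simp
    linarith
  have q5 : (‖surfFn (p t - P')‖ ^ 2 - ‖surfFn (p s - P)‖ ^ 2) / 2
      ≤ τ * inner ℝ (derivWithin (fun r => surfFn (p r)) (Icc 0 T) t) (surfFn (p t - P'))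
        - (inner ℝ (surfFn P') (surfFn (p t - P')) - inner ℝ (surfFn P) (surfFn (p t - P')))
        + Kd * τ ^ 2 * ‖surfFn (p t - P')‖ := by
    refine (half_sub_norm_sq_le_inner_sub_self _ _).trans ?_
    set dp := derivWithin (fun r => surfFn (p r)) (Icc 0 T) t
    have e1 : surfFn (p t - P') - surfFn (p s - P)
        = τ • dp - (surfFn P' - surfFn P)
          + (surfFn (p t) - surfFn (p s) - τ • dp) := by
      rw [surfFn_sub, surfFn_sub]
      abel
    rw [e1, inner_add_left, inner_sub_left, inner_sub_left, inner_smul_left]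
    simp only [RCLike.conj_to_real]
    gcongr
    exact (real_inner_le_norm _ _).trans (by gcongr)
  have r1 := mul_le_mul_of_nonneg_left (m1.trans' (neg_le_neg k1))
    (mul_pos hτ (inv_pos.2 hε)).le
  have r2 := mul_le_mul_of_nonneg_left (m2.trans' (neg_le_neg k2))
    (mul_pos hτ (inv_pos.2 hδ)).le
  -- The multipliers survive here and cancel against those of the surface equation, both being
  -- evaluated at the same trace.
  have s1 : M.ε * ‖bulkGrad (u t - U')‖ ^ 2 + M.ε⁻¹ * (I1 - I2)
      - M.ε * ((lam t).toFun ⟨_, htr.mem_HHalf⟩ - Λ'.toFun ⟨_, htr.mem_HHalf⟩)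
      = inner ℝ G' (bulkGrad (w t - V')) := by
    rw [← q1, ← q3]
    linarith
  have s2 := congrArg (τ * ·) s1
  have s3 := congrArg (τ * ·) hc1
  have s4 := congrArg (τ * (M.δ * M.κ) * ·) q2
  linarith

/-- Absorption of the gradient terms in the energy estimate for the error. -/
theorem error_recursion_of_energy_estimate {ε σ c₁ c₂ Ku Kp Kd Kw τ x x' y y' z z' a a' D' : ℝ} (hε : 0 < ε)
    (hσ : 0 < σ) (hτ : 0 < τ) (hc₁ : 0 ≤ c₁) (hc₂ : 0 ≤ c₂)
    (ha : a ^ 2 ≤ x * y) (ha' : a' ^ 2 ≤ x' * y')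
    (h : τ * ε * y' ^ 2 + τ * D' + (x' ^ 2 - x ^ 2) / (2 * σ) + (z' ^ 2 - z ^ 2) / 2
      ≤ τ * c₁ * ((Ku * τ + a) * a') + τ * c₂ * ((Kp * τ + z) * z')
        + Kd * τ ^ 2 * z' + x' * (Kw * τ ^ 2)) :
    x' ^ 2 / (2 * σ) + z' ^ 2 / 2 + τ * (ε / 4 * y' ^ 2) + τ * (ε / 2 * y' ^ 2 + D')
      ≤ x ^ 2 / (2 * σ) + z ^ 2 / 2 + τ * (ε / 4 * y ^ 2)
        + (2 * σ * (c₁ ^ 2 / ε + 1 / 2) + 2 * (c₂ + 1 / 2)) * τ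
          * ((x ^ 2 / (2 * σ) + z ^ 2 / 2 + τ * (ε / 4 * y ^ 2))
            + (x' ^ 2 / (2 * σ) + z' ^ 2 / 2 + τ * (ε / 4 * y' ^ 2)))
        + (c₁ * Ku ^ 2 + c₂ * Kp ^ 2 + Kd ^ 2 + Kw ^ 2) / 2 * τ ^ 3 := by
  have i1 : c₁ * ((Ku * τ + a) * a') ≤ c₁ * (Ku ^ 2 * τ ^ 2 / 2) + c₁ * a ^ 2 / 2
      + c₁ * a' ^ 2 := by
    have := mul_nonneg hc₁ (add_nonneg (sq_nonneg (Ku * τ - a')) (sq_nonneg (a - a')))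
    linarith
  have i2 : c₂ * ((Kp * τ + z) * z') ≤ c₂ * (Kp ^ 2 * τ ^ 2 / 2) + c₂ * z ^ 2 / 2
      + c₂ * z' ^ 2 := by
    have := mul_nonneg hc₂ (add_nonneg (sq_nonneg (Kp * τ - z')) (sq_nonneg (z - z')))
    linarith
  have i3 : Kd * τ * z' ≤ Kd ^ 2 * τ ^ 2 / 2 + z' ^ 2 / 2 := by
    linarith [sq_nonneg (Kd * τ - z')]
  have i4 : x' * (Kw * τ) ≤ Kw ^ 2 * τ ^ 2 / 2 + x' ^ 2 / 2 := by
    linarith [sq_nonneg (Kw * τ - x')]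
  -- The coefficient `ε` of `y' ^ 2` is split in three: `ε/4` absorbs the new error `a'` (in `i6`),
  -- `ε/4` is stored in the energy to pay for the old error `a` at the next step (as here), and
  -- `ε/2` remains as dissipation.
  have i5 : c₁ * a ^ 2 / 2 ≤ ε / 4 * y ^ 2 + c₁ ^ 2 / ε * x ^ 2 := by
    have e1 := mul_le_mul_of_nonneg_left ha hc₁
    have e2 : 0 ≤ (ε * y - c₁ * x) ^ 2 / (4 * ε) := by positivity
    have e3 : (ε * y - c₁ * x) ^ 2 / (4 * ε)
        = ε / 4 * y ^ 2 - c₁ * (x * y) / 2 + c₁ ^ 2 / ε * x ^ 2 / 4 := by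
      field_simp
      ring
    have e4 : 0 ≤ c₁ ^ 2 / ε * x ^ 2 := by positivity
    linarith
  have i6 : c₁ * a' ^ 2 ≤ ε / 4 * y' ^ 2 + c₁ ^ 2 / ε * x' ^ 2 := by
    have e1 := mul_le_mul_of_nonneg_left ha' hc₁
    have e2 : 0 ≤ (ε * y' - 2 * c₁ * x') ^ 2 / (4 * ε) := by positivity
    have e3 : (ε * y' - 2 * c₁ * x') ^ 2 / (4 * ε)
        = ε / 4 * y' ^ 2 - c₁ * (x' * y') + c₁ ^ 2 / ε * x' ^ 2 := by
      field_simp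
      ring
    linarith
  set α := c₁ ^ 2 / ε with hα
  have hα0 : 0 ≤ α := by positivity
  set X := x ^ 2 / (2 * σ) with hX
  set X' := x' ^ 2 / (2 * σ) with hX'
  have eX : x ^ 2 = 2 * σ * X := by rw [hX]; field_simp
  have eX' : x' ^ 2 = 2 * σ * X' := by rw [hX']; field_simp
  have hX0 : 0 ≤ X := by positivity
  have hX0' : 0 ≤ X' := by positivity
  have h1 : X' - X + (z' ^ 2 - z ^ 2) / 2 = (x' ^ 2 - x ^ 2) / (2 * σ) + (z' ^ 2 - z ^ 2) / 2 := by
    rw [hX, hX']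
    ring
  have hsum : c₁ * ((Ku * τ + a) * a') + c₂ * ((Kp * τ + z) * z') + Kd * τ * z' + x' * (Kw * τ)
      ≤ (c₁ * Ku ^ 2 + c₂ * Kp ^ 2 + Kd ^ 2 + Kw ^ 2) / 2 * τ ^ 2 + ε / 4 * y ^ 2
        + ε / 4 * y' ^ 2 + (2 * σ * (α + 1 / 2) + 2 * (c₂ + 1 / 2)) * ((X + z ^ 2 / 2
          + τ * (ε / 4 * y ^ 2)) + (X' + z' ^ 2 / 2 + τ * (ε / 4 * y' ^ 2))) := by
    have b1 : α * x ^ 2 + α * x' ^ 2 + x' ^ 2 / 2 ≤ 2 * σ * (α + 1 / 2) * (X + X') := by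
      rw [eX, eX']
      have := mul_nonneg hσ.le hX0
      linarith
    have b2 : c₂ * z ^ 2 / 2 + c₂ * z' ^ 2 + z' ^ 2 / 2
        ≤ 2 * (c₂ + 1 / 2) * (z ^ 2 / 2 + z' ^ 2 / 2) := by
      have := mul_nonneg hc₂ (sq_nonneg z)
      linarith [sq_nonneg z]
    have b3 : 2 * σ * (α + 1 / 2) * (X + X') + 2 * (c₂ + 1 / 2) * (z ^ 2 / 2 + z' ^ 2 / 2)
        ≤ (2 * σ * (α + 1 / 2) + 2 * (c₂ + 1 / 2)) * ((X + z ^ 2 / 2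
          + τ * (ε / 4 * y ^ 2)) + (X' + z' ^ 2 / 2 + τ * (ε / 4 * y' ^ 2))) := by
      have f1 : X + X' ≤ (X + z ^ 2 / 2
          + τ * (ε / 4 * y ^ 2)) + (X' + z' ^ 2 / 2 + τ * (ε / 4 * y' ^ 2)) := by
        have : 0 ≤ z ^ 2 / 2 + τ * (ε / 4 * y ^ 2) + (z' ^ 2 / 2 + τ * (ε / 4 * y' ^ 2)) := by
          positivity
        linarith
      have f2 : z ^ 2 / 2 + z' ^ 2 / 2 ≤ (X + z ^ 2 / 2
          + τ * (ε / 4 * y ^ 2)) + (X' + z' ^ 2 / 2 + τ * (ε / 4 * y' ^ 2)) := by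
        have : 0 ≤ X + τ * (ε / 4 * y ^ 2) + (X' + τ * (ε / 4 * y' ^ 2)) := by
          positivity
        linarith
      rw [add_mul (2 * σ * (α + 1 / 2))]
      gcongr
    linarith
  have := mul_le_mul_of_nonneg_left hsum hτ.le
  linarith

theorem norm_bulkGrad_le {d : ℕ} {Ω : Set (Space d)} (v : H1Bulk Ω) : ‖bulkGrad v‖ ≤ ‖v‖ := by
  refine le_of_sq_le_sq ?_ (norm_nonneg v)
  rw [norm_sq_bulk]
  linarith [sq_nonneg ‖bulkFn v‖]

theorem continuous_bulkGrad {d : ℕ} {Ω : Set (Space d)} :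
    Continuous (bulkGrad : H1Bulk Ω → L2BulkVec Ω) := by
  refine (LipschitzWith.of_dist_le_mul (K := 1) fun a b => ?_).continuous
  rw [dist_eq_norm, dist_eq_norm, ← bulkGrad_sub, NNReal.coe_one, one_mul]
  exact norm_bulkGrad_le _

/-- The error of `u` is represented in `H¹(Ω)*` by a field `G n`, which is bounded, together with
the error of `p` and the dissipation, to first order in the step size. -/
theorem Model.exists_error_bound {d : ℕ} {Ω : Set (Space d)} {M : Model} {J JΓ : Set ℝ}
    (hJ : J ⊆ M.I) (hJΓ : JΓ ⊆ M.IΓ) {L LΓ : ℝ≥0} (hL : LipschitzOnWith L (deriv M.Wm) J)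
    (hLΓ : LipschitzOnWith LΓ (deriv M.WΓm) JΓ) {T : ℝ} (hT : 0 < T)
    {u w : ℝ → H1Bulk Ω} {p : ℝ → H1Surf Ω} {lam : ℝ → HNegHalf Ω}
    (hsol : M.IsRegularSolution T u w p lam)
    (hvalues : ∀ t ∈ Icc 0 T, ValuesIn (u t) (p t) J JΓ) :
    ∃ C τ₀ : ℝ, 0 ≤ C ∧ 0 < τ₀ ∧ ∀ τ : ℝ, 0 < τ → τ ≤ τ₀ → ∀ N : ℕ, N * τ ≤ T →
      ∀ (U V : ℕ → H1Bulk Ω) (P : ℕ → H1Surf Ω) (Λ : ℕ → HNegHalf Ω),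
      U 0 = u 0 → P 0 = p 0 →
      (∀ n < N, M.IsStep τ (U n) (P n) (U (n + 1)) (V (n + 1)) (P (n + 1)) (Λ (n + 1))) →
      (∀ n ≤ N, ValuesIn (U n) (P n) J JΓ) →
      ∃ G : ℕ → L2BulkVec Ω,
        (∀ n ≤ N, ∀ v, inner ℝ (bulkFn (u (n * τ) - U n)) (bulkFn v)
          = inner ℝ (G n) (bulkGrad v)) ∧
        (∀ n ≤ N, ‖G n‖ ^ 2 / (2 * M.σ) + ‖surfFn (p (n * τ) - P n)‖ ^ 2 / 2 ≤ C * τ ^ 2) ∧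
        ∑ n ∈ Finset.Icc 1 N, τ * (M.ε / 2 * ‖bulkGrad (u (n * τ) - U n)‖ ^ 2
          + M.δ * M.κ * ‖surfGrad (p (n * τ) - P n)‖ ^ 2) ≤ C * τ ^ 2 := by
  have hε := M.ε_pos
  have hσ := M.σ_pos
  have hδ := M.δ_pos
  have hκ := M.κ_pos
  obtain ⟨Ku, hKu0, hKu⟩ := exists_norm_sub_le_of_contDiffOn hsol.reg_u
  obtain ⟨Kp, hKp0, hKp⟩ := exists_norm_sub_le_of_contDiffOn (hsol.reg_p.of_le (by norm_num))
  obtain ⟨Kd, hKd0, hKd⟩ := exists_norm_sub_sub_smul_derivWithin_le hT hsol.reg_p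
  obtain ⟨Kw, hKw0, hKw⟩ := exists_norm_sub_le_of_contDiffOn hsol.reg_w
  set g : ℝ → L2BulkVec Ω := fun t => bulkGrad (w t) with hg
  have hgc : ContinuousOn g (Icc 0 T) := continuous_bulkGrad.comp_continuousOn hsol.reg_w.continuousOn
  have hgL : ∀ s ∈ Icc 0 T, ∀ t ∈ Icc 0 T, ‖g t - g s‖ ≤ Kw * |t - s| := fun s hs t ht =>
    (norm_bulkGrad_le (w t - w s)).trans (hKw s hs t ht)
  set c₁ : ℝ := M.ε⁻¹ * L with hc₁
  set c₂ : ℝ := M.δ⁻¹ * LΓ with hc₂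
  have hc₁0 : 0 ≤ c₁ := by positivity
  have hc₂0 : 0 ≤ c₂ := by positivity
  set K : ℝ := 2 * M.σ * (c₁ ^ 2 / M.ε + 1 / 2) + 2 * (c₂ + 1 / 2) with hK
  have hK0 : 0 < K := by positivity
  set D : ℝ := (c₁ * Ku ^ 2 + c₂ * Kp ^ 2 + Kd ^ 2 + Kw ^ 2) / 2 with hD
  have hD0 : 0 ≤ D := by positivity
  -- The Gronwall constant, and the step size bound that is equivalent to `K * τ ≤ 1/2`.
  refine ⟨2 * D * T * Real.exp (4 * K * T), 1 / (2 * K), by positivity, by positivity, ?_⟩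
  intro τ hτ hττ N hN U V P Λ hU0 hP0 hstep hval
  have hKτ : K * τ ≤ 1 / 2 := by
    rw [le_div_iff₀ (by positivity)] at hττ
    linarith
  have hmem : ∀ n ≤ N, (n : ℝ) * τ ∈ Icc 0 T := fun n hn =>
    ⟨by positivity, le_trans (by gcongr) hN⟩
  have hdiff : ∀ n : ℕ, ((n + 1 : ℕ) : ℝ) * τ - n * τ = τ := fun n => by
    push_cast
    ring
  have hle : ∀ n : ℕ, (n : ℝ) * τ ≤ ((n + 1 : ℕ) : ℝ) * τ := fun n => by linarith [hdiff n]
  -- `G` accumulates the difference between the exact flux over a step and the discrete one;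
  -- consistent initial data allow `G 0 = 0`.
  obtain ⟨G, hG0, hGs⟩ : ∃ G : ℕ → L2BulkVec Ω, G 0 = 0 ∧ ∀ n : ℕ, G (n + 1) = G n
      - M.σ • ((∫ r in (n * τ)..((n + 1 : ℕ) * τ), g r) - τ • bulkGrad (V (n + 1))) :=
    ⟨fun n => Nat.rec 0 (fun n H => H
      - M.σ • ((∫ r in (n * τ)..((n + 1 : ℕ) * τ), g r) - τ • bulkGrad (V (n + 1)))) n,
      rfl, fun _ => rfl⟩
  have hGe : ∀ n ≤ N, ∀ v, inner ℝ (bulkFn (u (n * τ) - U n)) (bulkFn v)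
      = inner ℝ (G n) (bulkGrad v) := by
    intro n
    induction n with
    | zero =>
      intro _ v
      rw [hG0, bulkFn_sub, Nat.cast_zero, zero_mul, hU0, sub_self, inner_zero_left,
        inner_zero_left]
    | succ n ih =>
      intro hn v
      have e1 := inner_sub_eq_inner_integral_of_derivWithin hsol.reg_u hgc (hmem n (by omega))
        (hmem (n + 1) hn) (hle n) (fun r hr => hsol.eq_a r hr v)
      have e2 := (hstep n (by omega)).eq_a v
      have e3 := ih (by omega) v
      rw [bulkFn_sub, inner_sub_left] at e3 ⊢
      rw [inner_sub_left] at e1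
      rw [hGs, inner_sub_left, inner_smul_left, inner_sub_left, inner_smul_left]
      simp only [RCLike.conj_to_real]
      linarith
  -- Interpolation between the dual norm and the gradient norm: the representation is tested with
  -- the error itself.
  have hsq : ∀ n ≤ N, ‖bulkFn (u (n * τ) - U n)‖ ^ 2
      ≤ ‖G n‖ * ‖bulkGrad (u (n * τ) - U n)‖ := fun n hn => by
    rw [← real_inner_self_eq_norm_sq, hGe n hn]
    exact real_inner_le_norm _ _
  set A : ℕ → ℝ := fun n => ‖G n‖ ^ 2 / (2 * M.σ) + ‖surfFn (p (n * τ) - P n)‖ ^ 2 / 2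
    + τ * (M.ε / 4 * ‖bulkGrad (u (n * τ) - U n)‖ ^ 2) with hA
  set B : ℕ → ℝ := fun n => M.ε / 2 * ‖bulkGrad (u (n * τ) - U n)‖ ^ 2
    + M.δ * M.κ * ‖surfGrad (p (n * τ) - P n)‖ ^ 2 with hB
  have hA0 : A 0 = 0 := by
    have z1 : bulkGrad (0 : H1Bulk Ω) = 0 := rfl
    have z2 : surfFn (0 : H1Surf Ω) = 0 := rfl
    simp [hA, hG0, hU0, hP0, z1, z2]
  have hB0 : ∀ n, 0 ≤ B n := fun n => by positivity
  have hrec : ∀ n < N, A (n + 1) + τ * B (n + 1)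
      ≤ A n + K * τ * (A n + A (n + 1)) + D * τ ^ 3 := by
    intro n hn
    have hs := hmem n hn.le
    have ht := hmem (n + 1) hn
    have habs : |((n + 1 : ℕ) : ℝ) * τ - n * τ| = τ := by rw [hdiff, abs_of_pos hτ]
    have f1 := hKu _ hs _ ht
    have f2 := hKp _ hs _ ht
    have f3 := hKd _ hs _ ht (hle n)
    have f4 := norm_integral_sub_smul_le hgc hKw0 hgL hs ht (hle n)
    rw [habs] at f1 f2
    rw [hdiff] at f3 f4
    refine error_recursion_of_energy_estimate hε hσ hτ hc₁0 hc₂0 (hsq n hn.le) (hsq (n + 1) hn) ?_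
    have := (hstep n hn).error_inequality hτ hsol hJ hJΓ hL hLΓ ht f1 f2 f3 f4
      (G := G n) (G' := G (n + 1)) (by
        rw [hGs, bulkGrad_sub]
        congr 2
        rw [smul_sub]
        abel) (hGe (n + 1) hn)
      (hvalues _ ht) (hval n hn.le) (hval (n + 1) hn)
    rwa [mul_assoc τ (M.δ * M.κ)] at this
  have hfin := add_sum_le_of_implicit_recursion hK0.le hD0 hτ hKτ hN hA0 hB0 hrec
  have hA0' : ∀ n, 0 ≤ A n := fun n => by positivity
  refine ⟨G, hGe, fun n hn => ?_, ?_⟩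
  · have h1 := hfin n hn
    have h2 : 0 ≤ ∑ k ∈ Finset.Icc 1 n, τ * B k :=
      Finset.sum_nonneg fun k _ => mul_nonneg hτ.le (hB0 k)
    have h3 : 0 ≤ τ * (M.ε / 4 * ‖bulkGrad (u (n * τ) - U n)‖ ^ 2) := by positivity
    simp only [hA] at h1
    linarith
  · linarith [hfin N le_rfl, hA0' N]

theorem le_sqrt_mul_of_sq_le {a m τ : ℝ} (hτ : 0 ≤ τ) (h : a ^ 2 ≤ m * τ ^ 2) : a ≤ √m * τ := by
  calc a ≤ √(m * τ ^ 2) := Real.le_sqrt_of_sq_le h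
    _ = √m * τ := by rw [Real.sqrt_mul' _ (sq_nonneg τ), Real.sqrt_sq hτ]

theorem Model.first_order_accuracy {d : ℕ} {Ω : Set (Space d)} {M : Model} {J JΓ : Set ℝ}
    (hJ : J ⊆ M.I) (hJΓ : JΓ ⊆ M.IΓ) {L LΓ : ℝ≥0} (hL : LipschitzOnWith L (deriv M.Wm) J)
    (hLΓ : LipschitzOnWith LΓ (deriv M.WΓm) JΓ) {T : ℝ} (hT : 0 < T)
    {u w : ℝ → H1Bulk Ω} {p : ℝ → H1Surf Ω} {lam : ℝ → HNegHalf Ω}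
    (hsol : M.IsRegularSolution T u w p lam)
    (hvalues : ∀ t ∈ Icc 0 T, ValuesIn (u t) (p t) J JΓ) :
    ∃ C τ₀ : ℝ, 0 < τ₀ ∧ ∀ τ : ℝ, 0 < τ → τ ≤ τ₀ → ∀ N : ℕ, N * τ ≤ T →
      ∀ (U V : ℕ → H1Bulk Ω) (P : ℕ → H1Surf Ω) (Λ : ℕ → HNegHalf Ω),
      U 0 = u 0 → P 0 = p 0 →
      (∀ n < N, M.IsStep τ (U n) (P n) (U (n + 1)) (V (n + 1)) (P (n + 1)) (Λ (n + 1))) →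
      (∀ n ≤ N, ValuesIn (U n) (P n) J JΓ) →
      (∀ n ≤ N, ∀ v : H1Bulk Ω,
        |inner ℝ (bulkFn (u (n * τ)) - bulkFn (U n)) (bulkFn v)| ≤ C * τ * ‖v‖) ∧
      (∀ n ≤ N, ‖surfFn (p (n * τ)) - surfFn (P n)‖ ≤ C * τ) ∧
      √(∑ n ∈ Finset.Icc 1 N, τ * ‖u (n * τ) - U n‖ ^ 2) ≤ C * τ ∧
      √(∑ n ∈ Finset.Icc 1 N, τ * ‖p (n * τ) - P n‖ ^ 2) ≤ C * τ := by
  have hε := M.ε_pos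
  have hσ := M.σ_pos
  have hδκ := mul_pos M.δ_pos M.κ_pos
  obtain ⟨C, τ₀, hC, hτ₀, H⟩ := M.exists_error_bound hJ hJΓ hL hLΓ hT hsol hvalues
  -- The sum of four nonnegative constants, one for each of the four estimates, so that `√m` serves
  -- in all of them.
  set m : ℝ := 2 * M.σ * C + 2 * C + (T * (M.σ * C) + 3 / M.ε * C)
    + (T * (2 * C) + (M.δ * M.κ)⁻¹ * C) with hm
  have m1 : 0 ≤ 2 * M.σ * C := by positivity
  have m2 : 0 ≤ 2 * C := by positivity
  have m3 : 0 ≤ T * (M.σ * C) + 3 / M.ε * C := by positivity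
  have m4 : 0 ≤ T * (2 * C) + (M.δ * M.κ)⁻¹ * C := by positivity
  refine ⟨√m, τ₀, hτ₀, ?_⟩
  intro τ hτ hττ N hN U V P Λ hU0 hP0 hstep hval
  obtain ⟨G, hGe, hGA, hsum⟩ := H τ hτ hττ N hN U V P Λ hU0 hP0 hstep hval
  have hτ2 := sq_nonneg τ
  have hG : ∀ n ≤ N, ‖G n‖ ^ 2 ≤ 2 * M.σ * C * τ ^ 2 := fun n hn => by
    have h1 : ‖G n‖ ^ 2 / (2 * M.σ) ≤ C * τ ^ 2 := by
      linarith [hGA n hn, sq_nonneg ‖surfFn (p (n * τ) - P n)‖]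
    rw [div_le_iff₀ (by positivity)] at h1
    linarith
  have hp : ∀ n ≤ N, ‖surfFn (p (n * τ) - P n)‖ ^ 2 ≤ 2 * C * τ ^ 2 := fun n hn => by
    have : 0 ≤ ‖G n‖ ^ 2 / (2 * M.σ) := by positivity
    linarith [hGA n hn]
  have hcount : ∀ c : ℝ, 0 ≤ c → ∑ _n ∈ Finset.Icc 1 N, τ * c ≤ T * c := fun c hc => by
    rw [Finset.sum_const, Nat.card_Icc, Nat.add_sub_cancel, nsmul_eq_mul, ← mul_assoc]
    gcongr
  have hm' : ∀ {a : ℝ}, a ≤ m → a * τ ^ 2 ≤ m * τ ^ 2 := fun h =>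
    mul_le_mul_of_nonneg_right h hτ2
  refine ⟨fun n hn v => ?_, fun n hn => ?_, ?_, ?_⟩
  · rw [← bulkFn_sub, hGe n hn]
    refine (abs_real_inner_le_norm _ _).trans ?_
    gcongr
    · exact le_sqrt_mul_of_sq_le hτ.le ((hG n hn).trans (hm' (by linarith)))
    · exact norm_bulkGrad_le v
  · rw [← surfFn_sub]
    exact le_sqrt_mul_of_sq_le hτ.le ((hp n hn).trans (hm' (by linarith)))
  · refine le_sqrt_mul_of_sq_le hτ.le ?_
    rw [Real.sq_sqrt (Finset.sum_nonneg fun n _ => by positivity)]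
    refine le_trans ?_ (hm' (a := T * (M.σ * C) + 3 / M.ε * C) (by linarith))
    calc ∑ n ∈ Finset.Icc 1 N, τ * ‖u (n * τ) - U n‖ ^ 2
        ≤ ∑ n ∈ Finset.Icc 1 N, (τ * (M.σ * C * τ ^ 2) + 3 / M.ε * (τ * (M.ε / 2
          * ‖bulkGrad (u (n * τ) - U n)‖ ^ 2
          + M.δ * M.κ * ‖surfGrad (p (n * τ) - P n)‖ ^ 2))) := by
          refine Finset.sum_le_sum fun n hn => ?_
          have hn := (Finset.mem_Icc.1 hn).2
          have e1 : ‖bulkFn (u (n * τ) - U n)‖ ^ 2 ≤ ‖G n‖ * ‖bulkGrad (u (n * τ) - U n)‖ := by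
            rw [← real_inner_self_eq_norm_sq, hGe n hn]
            exact real_inner_le_norm _ _
          -- Young's inequality turns `‖G n‖ ‖∇e_u‖` into `‖G n‖²/2 + ‖∇e_u‖²/2`, and no Poincaré
          -- inequality is needed. The resulting `3/2` is `3/ε` times the dissipation weight `ε/2`.
          have e2 : ‖u (n * τ) - U n‖ ^ 2 ≤ M.σ * C * τ ^ 2
              + 3 / 2 * ‖bulkGrad (u (n * τ) - U n)‖ ^ 2 := by
            rw [norm_sq_bulk]
            linarith [hG n hn, sq_nonneg (‖G n‖ - ‖bulkGrad (u (n * τ) - U n)‖)]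
          have e3 : 0 ≤ 3 / M.ε * (τ * (M.δ * M.κ * ‖surfGrad (p (n * τ) - P n)‖ ^ 2)) := by
            positivity
          have e4 : 3 / M.ε * (τ * (M.ε / 2 * ‖bulkGrad (u (n * τ) - U n)‖ ^ 2))
              = τ * (3 / 2 * ‖bulkGrad (u (n * τ) - U n)‖ ^ 2) := by
            field_simp
          have e5 := mul_le_mul_of_nonneg_left e2 hτ.le
          linarith
      _ ≤ T * (M.σ * C * τ ^ 2) + 3 / M.ε * (C * τ ^ 2) := by
          rw [Finset.sum_add_distrib, ← Finset.mul_sum _ _ (3 / M.ε)]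
          exact add_le_add (hcount _ (by positivity)) (by gcongr)
      _ = (T * (M.σ * C) + 3 / M.ε * C) * τ ^ 2 := by ring
  · refine le_sqrt_mul_of_sq_le hτ.le ?_
    rw [Real.sq_sqrt (Finset.sum_nonneg fun n _ => by positivity)]
    refine le_trans ?_ (hm' (a := T * (2 * C) + (M.δ * M.κ)⁻¹ * C) (by linarith))
    calc ∑ n ∈ Finset.Icc 1 N, τ * ‖p (n * τ) - P n‖ ^ 2
        ≤ ∑ n ∈ Finset.Icc 1 N, (τ * (2 * C * τ ^ 2) + (M.δ * M.κ)⁻¹ * (τ * (M.ε / 2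
          * ‖bulkGrad (u (n * τ) - U n)‖ ^ 2
          + M.δ * M.κ * ‖surfGrad (p (n * τ) - P n)‖ ^ 2))) := by
          refine Finset.sum_le_sum fun n hn => ?_
          have hn := (Finset.mem_Icc.1 hn).2
          have e2 := mul_le_mul_of_nonneg_left (hp n hn) hτ.le
          have e3 : 0 ≤ (M.δ * M.κ)⁻¹ * (τ * (M.ε / 2
              * ‖bulkGrad (u (n * τ) - U n)‖ ^ 2)) := by positivity
          have e4 : (M.δ * M.κ)⁻¹ * (τ * (M.δ * M.κ * ‖surfGrad (p (n * τ) - P n)‖ ^ 2))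
              = τ * ‖surfGrad (p (n * τ) - P n)‖ ^ 2 := by
            rw [mul_left_comm τ, inv_mul_cancel_left₀ hδκ.ne']
          rw [norm_sq_surf]
          linarith
      _ ≤ T * (2 * C * τ ^ 2) + (M.δ * M.κ)⁻¹ * (C * τ ^ 2) := by
          rw [Finset.sum_add_distrib, ← Finset.mul_sum _ _ (M.δ * M.κ)⁻¹]
          exact add_le_add (hcount _ (by positivity)) (by gcongr)
      _ = (T * (2 * C) + (M.δ * M.κ)⁻¹ * C) * τ ^ 2 := by ring

end CahnHilliard

theorem proposition3p1 {d : ℕ} (hd : d = 2 ∨ d = 3) (Ω : Set (CahnHilliard.Space d))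
    (hΩ : CahnHilliard.IsBoundedLipschitzDomain Ω) (M : CahnHilliard.Model) :
    -- energy dissipation, for every step size and consistent initial data of finite energy
    (∀ (τ : ℝ), 0 < τ →
      ∀ (u w : ℕ → CahnHilliard.H1Bulk Ω) (p : ℕ → CahnHilliard.H1Surf Ω)
        (lam : ℕ → CahnHilliard.HNegHalf Ω),
      CahnHilliard.IsTrace (u 0) (CahnHilliard.surfFn (p 0)) →
      M.HasFiniteEnergy (u 0) (p 0) →
      (∀ n, M.IsStep τ (u n) (p n) (u (n + 1)) (w (n + 1)) (p (n + 1)) (lam (n + 1))) →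
      ∀ n, CahnHilliard.IsTrace (u n) (CahnHilliard.surfFn (p n)) ∧ M.HasFiniteEnergy (u n) (p n) ∧
        M.energy (u (n + 1)) (p (n + 1)) ≤ M.energy (u n) (p n)) ∧
    -- first-order accuracy
    (∀ (J JΓ : Set ℝ), J ⊆ M.I → JΓ ⊆ M.IΓ →
      (∃ L : ℝ≥0, LipschitzOnWith L (deriv M.Wm) J) →
      (∃ L : ℝ≥0, LipschitzOnWith L (deriv M.WΓm) JΓ) →
      ∀ (T : ℝ), 0 < T →
      ∀ (u w : ℝ → CahnHilliard.H1Bulk Ω) (p : ℝ → CahnHilliard.H1Surf Ω)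
        (lam : ℝ → CahnHilliard.HNegHalf Ω),
      M.IsRegularSolution T u w p lam →
      (∀ t ∈ Icc 0 T, CahnHilliard.ValuesIn (u t) (p t) J JΓ) →
      ∃ C τ₀ : ℝ, 0 < τ₀ ∧ ∀ τ : ℝ, 0 < τ → τ ≤ τ₀ → ∀ N : ℕ, N * τ ≤ T →
        ∀ (U V : ℕ → CahnHilliard.H1Bulk Ω) (P : ℕ → CahnHilliard.H1Surf Ω)
          (Λ : ℕ → CahnHilliard.HNegHalf Ω),
        U 0 = u 0 → P 0 = p 0 →
        (∀ n < N, M.IsStep τ (U n) (P n) (U (n + 1)) (V (n + 1)) (P (n + 1)) (Λ (n + 1))) →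
        (∀ n ≤ N, CahnHilliard.ValuesIn (U n) (P n) J JΓ) →
        (∀ n ≤ N, ∀ v : CahnHilliard.H1Bulk Ω,
          |inner ℝ (CahnHilliard.bulkFn (u (n * τ)) - CahnHilliard.bulkFn (U n)) (CahnHilliard.bulkFn v)| ≤ C * τ * ‖v‖) ∧
        (∀ n ≤ N, ‖CahnHilliard.surfFn (p (n * τ)) - CahnHilliard.surfFn (P n)‖ ≤ C * τ) ∧
        √(∑ n ∈ Finset.Icc 1 N, τ * ‖u (n * τ) - U n‖ ^ 2) ≤ C * τ ∧
        √(∑ n ∈ Finset.Icc 1 N, τ * ‖p (n * τ) - P n‖ ^ 2) ≤ C * τ) := by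
  have hd1 : 1 ≤ d := by omega
  have hbulk := hΩ.isFiniteMeasure_bulkMeasure
  have hsurf := hΩ.isFiniteMeasure_surfMeasure hd1
  refine ⟨fun τ hτ u w p lam htr hE h n => M.energy_dissipation hτ htr hE h n, ?_⟩
  rintro J JΓ hJ hJΓ ⟨L, hL⟩ ⟨LΓ, hLΓ⟩ T hT u w p lam hsol hvalues
  exact M.first_order_accuracy hJ hJΓ hL hLΓ hT hsol hvalues
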